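/- Let $\mathbb{K}$ be a field and $q\in\mathbb{K}$ a non-zero scalar. For $n\ge 1$ let $V_n=\mathbb{K}^n$ with basis $e_1,\dots,e_n$, and let $R_n$ be the endomorphism of $V_n\otimes V_n$ with $R_n(e_i\otimes e_j)=e_j\otimes e_i$ if $i<j$, $R_n(e_i\otimes e_i)=q\,e_i\otimes e_i$, and $R_n(e_i\otimes e_j)=(q-q^{-1})\,e_i\otimes e_j+e_j\otimes e_i$ if $i>j$. The Hecke algebra $\mathcal{H}_d$, with generators $T_1,\dots,T_{d-1}$, acts on $V_n^{\otimes d}$ by letting $T_i$ act as $\mathrm{Id}^{\otimes i-1}\otimes R_n\otimes\mathrm{Id}^{\otimes d-i-1}$. Let $S_q(n,m;d)=\mathrm{Hom}_{\mathcal{H}_d}(V_n^{\otimes d},V_m^{\otimes d})$, and let $\mathcal{C}_d$ be the $\mathbb{K}$-linear category with objects $V_n^{\otimes d}$, $n\ge 1$, and with these spaces of morphisms. A homogeneous quantum polynomial functor of degree $d\ge 0$ is a $\mathbb{K}$-linear functor $F$ from $\mathcal{C}_d$ to finite dimensional $\mathbb{K}$-vector spaces; write $F(n)=F(V_n^{\otimes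 d})$. They form an abelian category $\mathcal{P}_q^d$, and the category of quantum polynomial functors is the direct sum $\mathcal{P}_q=\bigoplus_{d\ge 0}\mathcal{P}_q^d$: its objects are the families $(A_d)_{d\ge 0}$ with $A_d\in\mathcal{P}_q^d$ and $A_d=0$ for all but finitely many $d$, and its morphisms are the families of morphisms. The tensor product of $F\in\mathcal{P}_q^{d_1}$ and $G\in\mathcal{P}_q^{d_2}$ is the functor $F\otimes G\in\mathcal{P}_q^{d_1+d_2}$ with $(F\otimes G)(n)=F(n)\otimes G(n)$ and $(F\otimes G)(f)=\sum F(f_1)\otimes G(f_2)$, where $f=\sum f_1\otimes f_2$ is the decomposition of $f\in S_q(n,m;d_1+d_2)$ in $S_q(n,m;d_1)\otimes S_q(n,m;d_2)$. A composition $\alpha=(\alpha_1,\dots,\alpha_n)$ of $d$ into $n$ parts $\alpha_i\geq 0$ is a weight of $A\in\mathcal{P}_q$ if $A_d(\xi_\alpha)\ne 0$, where $\xi_\alpha\in S_q(n,n;d)$ is the projector of $V_n^{\otimes d}$ onto the span of those $e_{i_1}\otimes\cdots\otimes e_{i_d}$ in which each index $j$ occurs exactly $\alpha_j$ times, along the span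 of the other basis vectors. Let $k\ge 0$ and let $A\in\mathcal{P}_q$ be such that every weight of $A$ has at most $k$ non-zero parts. Let $F_1,\dots,F_{k+1}$ be homogeneous quantum polynomial functors of degrees $\ge 1$. Then $$\mathrm{Ext}^s_{\mathcal{P}_q}(A,F_1\otimes\cdots\otimes F_{k+1})=0\qquad\text{for all } s\ge 0.$$ -/

import Mathlib

open CategoryTheory Limits
open scoped TensorProduct

universe u

noncomputable section

namespace QuantumFunctor

/-! ### The spaces `V_n^{⊗ d}` and the Hecke operators -/

section Hecke

variable {K : Type u} [Field K]

/-- The `d`-th tensor power of `V_n = K^n`. -/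
def TensorSpace (K : Type u) [Field K] (n d : ℕ) : Type u := ⨂[K]^d (Fin n → K)

instance (n d : ℕ) : AddCommGroup (TensorSpace K n d) :=
  inferInstanceAs (AddCommGroup (⨂[K]^d (Fin n → K)))

instance (n d : ℕ) : Module K (TensorSpace K n d) :=
  inferInstanceAs (Module K (⨂[K]^d (Fin n → K)))

/-- The basis `e_w = e_{w 0} ⊗ ⋯ ⊗ e_{w (d - 1)}` of `V_n^{⊗ d}`, indexed by words `w` of
length `d` in `n` letters. -/
def wordBasis (K : Type u) [Field K] (n d : ℕ) :
    Module.Basis (Fin d → Fin n) K (TensorSpace K n d) :=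
  Basis.piTensorProduct fun _ => Pi.basisFun K (Fin n)

theorem wordBasis_apply (n d : ℕ) (w : Fin d → Fin n) :
    wordBasis K n d w =
      (PiTensorProduct.tprod K fun i => Pi.basisFun K (Fin n) (w i) : ⨂[K]^d (Fin n → K)) :=
  Basis.piTensorProduct_apply _ _

instance (n d : ℕ) : Module.Finite K (TensorSpace K n d) :=
  Module.Finite.of_basis (wordBasis K n d)

/-- The word obtained by exchanging the letters in positions `i` and `i + 1`. -/
def swapWord {n d : ℕ} (i : ℕ) (hi : i + 1 < d) (w : Fin d → Fin n) : Fin d → Fin n :=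
  w ∘ Equiv.swap ⟨i, Nat.lt_of_succ_lt hi⟩ ⟨i + 1, hi⟩

/-- The action of a generator of the Hecke algebra on `V_n^{⊗ d}` : the operator
`Id ⊗ R_n ⊗ Id`, where the Yang-Baxter operator `R_n` acts on the factors in positions
`i` and `i + 1` (counted from `0`). Explicitly, `R_n (e_a ⊗ e_b)` is `e_b ⊗ e_a` if `a < b`,
`q e_b ⊗ e_a` if `a = b`, and `(q - q⁻¹) e_a ⊗ e_b + e_b ⊗ e_a` if `a > b`. -/
def heckeT (q : K) (n d : ℕ) (i : ℕ) (hi : i + 1 < d) :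
    TensorSpace K n d →ₗ[K] TensorSpace K n d :=
  (wordBasis K n d).constr K fun w =>
    if w ⟨i, Nat.lt_of_succ_lt hi⟩ < w ⟨i + 1, hi⟩ then
      wordBasis K n d (swapWord i hi w)
    else if w ⟨i, Nat.lt_of_succ_lt hi⟩ = w ⟨i + 1, hi⟩ then
      q • wordBasis K n d (swapWord i hi w)
    else
      (q - q⁻¹) • wordBasis K n d w + wordBasis K n d (swapWord i hi w)

/-- The rectangular `q`-Schur bimodule `S_q(n, m; d)` : the space of linear maps
`V_n^{⊗ d} → V_m^{⊗ d}` that are linear over the Hecke algebra, that is, that commute with the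
action of its generators. -/
def schur (q : K) (n m d : ℕ) : Submodule K (TensorSpace K n d →ₗ[K] TensorSpace K m d) where
  carrier := {f | ∀ (i : ℕ) (hi : i + 1 < d), f ∘ₗ heckeT q n d i hi = heckeT q m d i hi ∘ₗ f}
  add_mem' := by
    intro f g hf hg i hi
    rw [LinearMap.add_comp, LinearMap.comp_add, hf i hi, hg i hi]
  zero_mem' := by
    intro i hi
    rw [LinearMap.zero_comp, LinearMap.comp_zero]
  smul_mem' := by
    intro c f hf i hi
    rw [LinearMap.smul_comp, LinearMap.comp_smul, hf i hi]

/-- The identity as an element of `S_q(n, n; d)`. -/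
def schurId (q : K) (n d : ℕ) : schur q n n d :=
  ⟨LinearMap.id, fun i hi => by rw [LinearMap.id_comp, LinearMap.comp_id]⟩

/-- The composition `S_q(r, m; d) × S_q(n, r; d) → S_q(n, m; d)`. -/
def schurComp {q : K} {n r m d : ℕ} (g : schur q r m d) (f : schur q n r d) : schur q n m d :=
  ⟨g.1 ∘ₗ f.1, fun i hi => by
    rw [LinearMap.comp_assoc, f.2 i hi, ← LinearMap.comp_assoc, g.2 i hi, LinearMap.comp_assoc]⟩

/-! ### The weight idempotents -/

/-- The composition of `d` attached to a word: how often each letter occurs. -/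
def content {n d : ℕ} (w : Fin d → Fin n) : Fin n → ℕ :=
  fun j => (Finset.univ.filter fun i => w i = j).card

theorem content_swapWord {n d : ℕ} (i : ℕ) (hi : i + 1 < d) (w : Fin d → Fin n) :
    content (swapWord i hi w) = content w := by
  funext j
  unfold content swapWord
  refine Finset.card_equiv (Equiv.swap ⟨i, Nat.lt_of_succ_lt hi⟩ ⟨i + 1, hi⟩) ?_
  intro a
  simp

/-- The projector of `V_n^{⊗ d} = ⨁_β V_β` onto `V_α`. The Hecke submodule `V_α` generated by
`e_1^{⊗ α_1} ⊗ ⋯ ⊗ e_n^{⊗ α_n}` is spanned by the basis vectors `e_w` such that `w` has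
content `α`. -/
def weightProj (K : Type u) [Field K] (n d : ℕ) (α : Fin n → ℕ) :
    TensorSpace K n d →ₗ[K] TensorSpace K n d :=
  (wordBasis K n d).constr K fun w => if content w = α then wordBasis K n d w else 0

/-- The idempotent `ξ_α` of the `q`-Schur algebra `S_q(n, n; d)`. -/
def xi (q : K) (n d : ℕ) (α : Fin n → ℕ) : schur q n n d :=
  ⟨weightProj K n d α, by
    intro i hi
    refine (wordBasis K n d).ext fun w => ?_
    have h := content_swapWord i hi w
    simp only [LinearMap.comp_apply, heckeT, weightProj, Module.Basis.constr_basis]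
    split_ifs <;> simp only [map_add, map_smul, map_zero, Module.Basis.constr_basis] <;>
      simp_all only [if_true, if_false, smul_zero, add_zero, lt_irrefl]⟩

/-! ### The comultiplication of the `q`-Schur bimodules -/

/-- The identification `V_n^{⊗ d₁} ⊗ V_n^{⊗ d₂} = V_n^{⊗ (d₁ + d₂)}` by concatenation. -/
def concat (K : Type u) [Field K] (n d₁ d₂ : ℕ) :
    TensorSpace K n d₁ ⊗[K] TensorSpace K n d₂ ≃ₗ[K] TensorSpace K n (d₁ + d₂) :=
  TensorPower.mulEquiv

theorem concat_wordBasis {n d₁ d₂ : ℕ} (w₁ : Fin d₁ → Fin n) (w₂ : Fin d₂ → Fin n) :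
    concat K n d₁ d₂ (wordBasis K n d₁ w₁ ⊗ₜ wordBasis K n d₂ w₂) =
      wordBasis K n (d₁ + d₂) (Fin.append w₁ w₂) := by
  rw [wordBasis_apply, wordBasis_apply, wordBasis_apply]
  refine (TensorPower.tprod_mul_tprod K _ _).trans ?_
  refine congrArg (PiTensorProduct.tprod K) (funext fun i => ?_)
  refine Fin.addCases (fun i => ?_) (fun i => ?_) i <;> simp

theorem swapWord_append_left {n d₁ d₂ : ℕ} (i : ℕ) (hi : i + 1 < d₁) (hi' : i + 1 < d₁ + d₂)
    (w₁ : Fin d₁ → Fin n) (w₂ : Fin d₂ → Fin n) :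
    swapWord i hi' (Fin.append w₁ w₂) = Fin.append (swapWord i hi w₁) w₂ := by
  funext a
  refine Fin.addCases (fun a => ?_) (fun a => ?_) a
  · have : Equiv.swap (⟨i, by omega⟩ : Fin (d₁ + d₂)) ⟨i + 1, hi'⟩ (Fin.castAdd d₂ a) =
        Fin.castAdd d₂ (Equiv.swap (⟨i, by omega⟩ : Fin d₁) ⟨i + 1, hi⟩ a) := by
      simp only [Equiv.swap_apply_def, Fin.ext_iff, Fin.val_castAdd]
      split_ifs <;> simp
    simp [swapWord, this]
  · have : Equiv.swap (⟨i, by omega⟩ : Fin (d₁ + d₂)) ⟨i + 1, hi'⟩ (Fin.natAdd d₁ a) =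
        Fin.natAdd d₁ a := by
      apply Equiv.swap_apply_of_ne_of_ne <;> simp only [ne_eq, Fin.ext_iff, Fin.val_natAdd] <;>
        omega
    simp [swapWord, this]

theorem swapWord_append_right {n d₁ d₂ : ℕ} (i : ℕ) (hi : i + 1 < d₂)
    (hi' : d₁ + i + 1 < d₁ + d₂) (w₁ : Fin d₁ → Fin n) (w₂ : Fin d₂ → Fin n) :
    swapWord (d₁ + i) hi' (Fin.append w₁ w₂) = Fin.append w₁ (swapWord i hi w₂) := by
  funext a
  refine Fin.addCases (fun a => ?_) (fun a => ?_) a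
  · have : Equiv.swap (⟨d₁ + i, by omega⟩ : Fin (d₁ + d₂)) ⟨d₁ + i + 1, hi'⟩ (Fin.castAdd d₂ a) =
        Fin.castAdd d₂ a := by
      apply Equiv.swap_apply_of_ne_of_ne <;> simp only [ne_eq, Fin.ext_iff, Fin.val_castAdd] <;>
        omega
    simp [swapWord, this]
  · have : Equiv.swap (⟨d₁ + i, by omega⟩ : Fin (d₁ + d₂)) ⟨d₁ + i + 1, hi'⟩ (Fin.natAdd d₁ a) =
        Fin.natAdd d₁ (Equiv.swap (⟨i, by omega⟩ : Fin d₂) ⟨i + 1, hi⟩ a) := by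
      simp only [Equiv.swap_apply_def, Fin.ext_iff, Fin.val_natAdd]
      split_ifs <;> simp <;> omega
    simp [swapWord, this]

theorem heckeT_concat_left (q : K) (n d₁ d₂ : ℕ) (i : ℕ) (hi : i + 1 < d₁) :
    heckeT q n (d₁ + d₂) i (by omega) ∘ₗ (concat K n d₁ d₂).toLinearMap =
      (concat K n d₁ d₂).toLinearMap ∘ₗ
        TensorProduct.map (heckeT q n d₁ i hi) LinearMap.id := by
  refine ((wordBasis K n d₁).tensorProduct (wordBasis K n d₂)).ext fun ⟨w₁, w₂⟩ => ?_
  have h1 : Fin.append w₁ w₂ ⟨i, by omega⟩ = w₁ ⟨i, by omega⟩ :=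
    Fin.append_left w₁ w₂ ⟨i, by omega⟩
  have h2 : Fin.append w₁ w₂ ⟨i + 1, by omega⟩ = w₁ ⟨i + 1, hi⟩ :=
    Fin.append_left w₁ w₂ ⟨i + 1, hi⟩
  simp only [LinearMap.comp_apply, Module.Basis.tensorProduct_apply, LinearEquiv.coe_coe,
    concat_wordBasis, heckeT, Module.Basis.constr_basis, TensorProduct.map_tmul, h1, h2,
    LinearMap.id_apply, swapWord_append_left i hi]
  split_ifs <;>
    simp only [TensorProduct.add_tmul, ← TensorProduct.smul_tmul', map_add, map_smul,
      concat_wordBasis]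

theorem heckeT_concat_right (q : K) (n d₁ d₂ : ℕ) (i : ℕ) (hi : i + 1 < d₂) :
    heckeT q n (d₁ + d₂) (d₁ + i) (by omega) ∘ₗ (concat K n d₁ d₂).toLinearMap =
      (concat K n d₁ d₂).toLinearMap ∘ₗ
        TensorProduct.map LinearMap.id (heckeT q n d₂ i hi) := by
  refine ((wordBasis K n d₁).tensorProduct (wordBasis K n d₂)).ext fun ⟨w₁, w₂⟩ => ?_
  have h1 : Fin.append w₁ w₂ ⟨d₁ + i, by omega⟩ = w₂ ⟨i, by omega⟩ :=
    Fin.append_right w₁ w₂ ⟨i, by omega⟩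
  have h2 : Fin.append w₁ w₂ ⟨d₁ + i + 1, by omega⟩ = w₂ ⟨i + 1, hi⟩ :=
    Fin.append_right w₁ w₂ ⟨i + 1, hi⟩
  simp only [LinearMap.comp_apply, Module.Basis.tensorProduct_apply, LinearEquiv.coe_coe,
    concat_wordBasis, heckeT, Module.Basis.constr_basis, TensorProduct.map_tmul, h1, h2,
    LinearMap.id_apply, swapWord_append_right i hi]
  split_ifs <;>
    simp only [TensorProduct.tmul_add, TensorProduct.tmul_smul, map_add, map_smul,
      concat_wordBasis]

theorem exists_rTensor_subtype {M N P : Type*} [AddCommGroup M] [Module K M] [AddCommGroup N]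
    [Module K N] [AddCommGroup P] [Module K P] {ι : Type*} (φ : ι → M →ₗ[K] P)
    (S : Submodule K M) (hS : ∀ x, (∀ i, φ i x = 0) → x ∈ S) (x : M ⊗[K] N)
    (hx : ∀ i, (φ i).rTensor N x = 0) : ∃ y : S ⊗[K] N, S.subtype.rTensor N y = x := by
  classical
  let b := Module.Basis.ofVectorSpace K N
  have key (i) (z : M ⊗[K] N) (j) :
      TensorProduct.equivFinsuppOfBasisRight b ((φ i).rTensor N z) j =
        φ i (TensorProduct.equivFinsuppOfBasisRight b z j) := by
    induction z with
    | zero => simp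
    | add a c ha hc => simp only [map_add, Finsupp.add_apply, ha, hc]
    | tmul m n => simp
  let e := TensorProduct.equivFinsuppOfBasisRight (M := M) b
  have hmem (j) : e x j ∈ S := hS _ fun i => by rw [← key, hx i]; simp
  refine ⟨(e x).sum fun j _ => (⟨e x j, hmem j⟩ : S) ⊗ₜ b j, ?_⟩
  rw [Finsupp.sum, map_sum]
  conv_rhs => rw [← e.symm_apply_apply x]
  rw [TensorProduct.equivFinsuppOfBasisRight_symm_apply, Finsupp.sum]
  rfl

theorem exists_lTensor_subtype {M N P : Type*} [AddCommGroup M] [Module K M] [AddCommGroup N]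
    [Module K N] [AddCommGroup P] [Module K P] {ι : Type*} (φ : ι → M →ₗ[K] P)
    (S : Submodule K M) (hS : ∀ x, (∀ i, φ i x = 0) → x ∈ S) (x : N ⊗[K] M)
    (hx : ∀ i, (φ i).lTensor N x = 0) : ∃ y : N ⊗[K] S, S.subtype.lTensor N y = x := by
  obtain ⟨y, hy⟩ := exists_rTensor_subtype φ S hS (TensorProduct.comm K N M x) fun i => by
    rw [LinearMap.rTensor, TensorProduct.map_comm, ← LinearMap.lTensor, hx i, map_zero]
  refine ⟨TensorProduct.comm K S N y, (TensorProduct.comm K N M).injective ?_⟩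
  rw [← hy, LinearMap.lTensor, TensorProduct.map_comm]
  exact (TensorProduct.comm K M N).symm_apply_apply _

/-- The map sending `f₁ ⊗ f₂` to the tensor product of the linear maps `f₁` and `f₂`. -/
def schurTensor (q : K) (n m d₁ d₂ : ℕ) :
    schur q n m d₁ ⊗[K] schur q n m d₂ →ₗ[K]
      (TensorSpace K n d₁ ⊗[K] TensorSpace K n d₂ →ₗ[K]
        TensorSpace K m d₁ ⊗[K] TensorSpace K m d₂) :=
  TensorProduct.homTensorHomMap (.id K) _ _ _ _ ∘ₗ
    TensorProduct.map (schur q n m d₁).subtype (schur q n m d₂).subtype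

@[simp]
theorem schurTensor_tmul (q : K) (n m d₁ d₂ : ℕ) (f₁ : schur q n m d₁) (f₂ : schur q n m d₂) :
    schurTensor q n m d₁ d₂ (f₁ ⊗ₜ f₂) = TensorProduct.map f₁.1 f₂.1 := rfl

theorem homTensorHomMap_injective (M N P Q : Type*) [AddCommGroup M] [Module K M]
    [AddCommGroup N] [Module K N] [AddCommGroup P] [Module K P] [AddCommGroup Q] [Module K Q]
    [Module.Finite K M] [Module.Finite K N] :
    Function.Injective (TensorProduct.homTensorHomMap (.id K) M N P Q) := by
  rw [← homTensorHomEquiv_toLinearMap]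
  exact (homTensorHomEquiv K M N P Q).injective

theorem schurTensor_injective (q : K) (n m d₁ d₂ : ℕ) :
    Function.Injective (schurTensor q n m d₁ d₂) :=
  (homTensorHomMap_injective _ _ _ _).comp
    (TensorProduct.map_injective_of_flat_flat _ _ (Submodule.subtype_injective _)
      (Submodule.subtype_injective _))

/-- A map that is linear over the product of two Hecke algebras is a sum of tensor products of
Hecke linear maps. -/
theorem mem_range_schurTensor (q : K) (n m d₁ d₂ : ℕ)
    (g : TensorSpace K n d₁ ⊗[K] TensorSpace K n d₂ →ₗ[K]
      TensorSpace K m d₁ ⊗[K] TensorSpace K m d₂)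
    (h₁ : ∀ (i : ℕ) (hi : i + 1 < d₁),
      g ∘ₗ TensorProduct.map (heckeT q n d₁ i hi) LinearMap.id =
        TensorProduct.map (heckeT q m d₁ i hi) LinearMap.id ∘ₗ g)
    (h₂ : ∀ (i : ℕ) (hi : i + 1 < d₂),
      g ∘ₗ TensorProduct.map LinearMap.id (heckeT q n d₂ i hi) =
        TensorProduct.map LinearMap.id (heckeT q m d₂ i hi) ∘ₗ g) :
    g ∈ LinearMap.range (schurTensor q n m d₁ d₂) := by
  let φ (d : ℕ) (i : {i : ℕ // i + 1 < d}) :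
      (TensorSpace K n d →ₗ[K] TensorSpace K m d) →ₗ[K]
        (TensorSpace K n d →ₗ[K] TensorSpace K m d) :=
    LinearMap.lcomp K _ (heckeT q n d i.1 i.2) - LinearMap.llcomp K _ _ _ (heckeT q m d i.1 i.2)
  have hφ (d : ℕ) (f) (hf : ∀ i, φ d i f = 0) : f ∈ schur q n m d := by
    intro i hi
    exact sub_eq_zero.1 (hf ⟨i, hi⟩)
  let H := TensorProduct.homTensorHomMap (.id K) (TensorSpace K n d₁) (TensorSpace K n d₂)
    (TensorSpace K m d₁) (TensorSpace K m d₂)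
  have hH : Function.Injective H := homTensorHomMap_injective _ _ _ _
  obtain ⟨x, rfl⟩ : ∃ x, H x = g :=
    ⟨(homTensorHomEquiv K _ _ _ _).symm g, by
      rw [← homTensorHomEquiv_apply, LinearEquiv.apply_symm_apply]⟩
  have k₁ (i) (z) : H ((φ d₁ i).rTensor _ z) =
      H z ∘ₗ TensorProduct.map (heckeT q n d₁ i.1 i.2) LinearMap.id -
        TensorProduct.map (heckeT q m d₁ i.1 i.2) LinearMap.id ∘ₗ H z := by
    induction z with
    | zero => simp
    | add a b ha hb =>
      rw [map_add, map_add, ha, hb, map_add, LinearMap.add_comp, LinearMap.comp_add]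
      abel
    | tmul a b =>
      refine TensorProduct.ext' fun v w => ?_
      simp [H, φ]
  have k₂ (i) (z) : H ((φ d₂ i).lTensor _ z) =
      H z ∘ₗ TensorProduct.map LinearMap.id (heckeT q n d₂ i.1 i.2) -
        TensorProduct.map LinearMap.id (heckeT q m d₂ i.1 i.2) ∘ₗ H z := by
    induction z with
    | zero => simp
    | add a b ha hb =>
      rw [map_add, map_add, ha, hb, map_add, LinearMap.add_comp, LinearMap.comp_add]
      abel
    | tmul a b =>
      refine TensorProduct.ext' fun v w => ?_
      simp [H, φ]
  obtain ⟨y, rfl⟩ := exists_rTensor_subtype (φ d₁) (schur q n m d₁) (hφ d₁) x fun i => by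
    apply hH
    rw [k₁, map_zero, h₁, sub_self]
  obtain ⟨z, rfl⟩ := exists_lTensor_subtype (φ d₂) (schur q n m d₂) (hφ d₂) y fun i => by
    apply Module.Flat.rTensor_preserves_injective_linearMap (schur q n m d₁).subtype
      (Submodule.subtype_injective _)
    apply hH
    have : (schur q n m d₁).subtype.rTensor _ ((φ d₂ i).lTensor _ y) =
        (φ d₂ i).lTensor _ ((schur q n m d₁).subtype.rTensor _ y) := by
      rw [← LinearMap.comp_apply, ← LinearMap.comp_apply, LinearMap.rTensor_comp_lTensor,
        LinearMap.lTensor_comp_rTensor]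
    rw [this, k₂, map_zero, map_zero, h₂, sub_self]
  refine ⟨z, ?_⟩
  exact congrArg H (LinearMap.congr_fun (LinearMap.rTensor_comp_lTensor _ _ _) z).symm

theorem concat_conj_mem_range (q : K) (n m d₁ d₂ : ℕ) (f : schur q n m (d₁ + d₂)) :
    (concat K m d₁ d₂).symm.toLinearMap ∘ₗ f.1 ∘ₗ (concat K n d₁ d₂).toLinearMap ∈
      LinearMap.range (schurTensor q n m d₁ d₂) := by
  apply mem_range_schurTensor
  · intro i hi
    refine LinearMap.ext fun x => (concat K m d₁ d₂).injective ?_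
    have e₁ (y) := LinearMap.congr_fun (heckeT_concat_left q n d₁ d₂ i hi) y
    have e₂ (y) := LinearMap.congr_fun (heckeT_concat_left q m d₁ d₂ i hi) y
    have e₃ (y) := LinearMap.congr_fun (f.2 i (by omega)) y
    simp only [LinearMap.comp_apply, LinearEquiv.coe_coe] at e₁ e₂ e₃ ⊢
    rw [LinearEquiv.apply_symm_apply, ← e₁, e₃, ← e₂, LinearEquiv.apply_symm_apply]
  · intro i hi
    refine LinearMap.ext fun x => (concat K m d₁ d₂).injective ?_
    have e₁ (y) := LinearMap.congr_fun (heckeT_concat_right q n d₁ d₂ i hi) y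
    have e₂ (y) := LinearMap.congr_fun (heckeT_concat_right q m d₁ d₂ i hi) y
    have e₃ (y) := LinearMap.congr_fun (f.2 (d₁ + i) (by omega)) y
    simp only [LinearMap.comp_apply, LinearEquiv.coe_coe] at e₁ e₂ e₃ ⊢
    rw [LinearEquiv.apply_symm_apply, ← e₁, e₃, ← e₂, LinearEquiv.apply_symm_apply]

/-- The comultiplication `Δ : S_q(n, m; d₁ + d₂) → S_q(n, m; d₁) ⊗ S_q(n, m; d₂)`. It sends `f`
to the unique `∑ f₁ ⊗ f₂` that equals `f` as a linear map
`V_n^{⊗ d₁} ⊗ V_n^{⊗ d₂} → V_m^{⊗ d₁} ⊗ V_m^{⊗ d₂}`. -/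
def schurComul (q : K) (n m d₁ d₂ : ℕ) :
    schur q n m (d₁ + d₂) →ₗ[K] schur q n m d₁ ⊗[K] schur q n m d₂ :=
  (LinearEquiv.ofInjective (schurTensor q n m d₁ d₂)
      (schurTensor_injective q n m d₁ d₂)).symm.toLinearMap ∘ₗ
    LinearMap.codRestrict _
      (LinearMap.llcomp K _ _ _ (concat K m d₁ d₂).symm.toLinearMap ∘ₗ
        LinearMap.lcomp K _ (concat K n d₁ d₂).toLinearMap ∘ₗ (schur q n m (d₁ + d₂)).subtype)
      (concat_conj_mem_range q n m d₁ d₂)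

theorem schurTensor_schurComul (q : K) (n m d₁ d₂ : ℕ) (f : schur q n m (d₁ + d₂)) :
    schurTensor q n m d₁ d₂ (schurComul q n m d₁ d₂ f) =
      (concat K m d₁ d₂).symm.toLinearMap ∘ₗ f.1 ∘ₗ (concat K n d₁ d₂).toLinearMap :=
  congrArg Subtype.val (LinearEquiv.apply_symm_apply
    (LinearEquiv.ofInjective (schurTensor q n m d₁ d₂) (schurTensor_injective q n m d₁ d₂)) _)

end Hecke

/-! ### The source categories and homogeneous quantum polynomial functors -/

/-- The objects `V_n^{⊗ d}`, `n ≥ 1`, of the source category of degree `d`. -/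
structure Source {K : Type u} [Field K] (q : K) (d : ℕ) where
  /-- The number `n ≥ 1`. -/
  rank : ℕ+

section Functors

variable {K : Type u} [Field K] {q : K}

instance (d : ℕ) : Category.{u} (Source q d) where
  Hom X Y := schur q X.rank Y.rank d
  id X := schurId q X.rank d
  comp f g := schurComp g f
  id_comp _ := rfl
  comp_id _ := rfl
  assoc _ _ _ := rfl

instance (d : ℕ) : Preadditive (Source q d) where
  homGroup X Y := inferInstanceAs (AddCommGroup (schur q X.rank Y.rank d))
  add_comp _ _ _ f f' g := Subtype.ext (LinearMap.comp_add f.1 f'.1 g.1)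
  comp_add _ _ _ f g g' := Subtype.ext (LinearMap.add_comp f.1 g'.1 g.1)

instance (d : ℕ) : CategoryTheory.Linear K (Source q d) where
  homModule X Y := inferInstanceAs (Module K (schur q X.rank Y.rank d))
  smul_comp _ _ _ c f g := Subtype.ext (LinearMap.comp_smul g.1 c f.1)
  comp_smul _ _ _ f c g := Subtype.ext (LinearMap.smul_comp c g.1 f.1)

/-- A functor from the source category of degree `d` to finite dimensional vector spaces is
`K`-linear. -/
def IsKLinear {d : ℕ} (F : Source q d ⥤ FGModuleCat.{u} K) : Prop :=
  F.Additive ∧ F.Linear K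

variable (q) in
/-- The category of homogeneous quantum polynomial functors of degree `d` : the `K`-linear
functors from the source category of degree `d` to finite dimensional vector spaces. -/
abbrev HomogFunctor (d : ℕ) : Type (u + 1) :=
  ObjectProperty.FullSubcategory (C := Source q d ⥤ FGModuleCat.{u} K) IsKLinear

/-- The value `F(n)`, for `n ≥ 1`. -/
abbrev HomogFunctor.val {d : ℕ} (F : HomogFunctor q d) (n : ℕ+) : Type u :=
  F.obj.obj (⟨n⟩ : Source q d)

/-- The action of `S_q(n, m; d)` on the values of `F`. -/
def HomogFunctor.act {d : ℕ} (F : HomogFunctor q d) (n m : ℕ+) :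
    schur q n m d →ₗ[K] F.val n →ₗ[K] F.val m where
  toFun f := (F.obj.map (X := ⟨n⟩) (Y := ⟨m⟩) f).hom.hom
  map_add' f g := by
    have := F.property.1
    have h := F.obj.map_add (X := ⟨n⟩) (Y := ⟨m⟩) (f := f) (g := g)
    exact congrArg (fun φ => φ.hom.hom) h
  map_smul' c f := by
    have := F.property.2
    have h := Functor.Linear.map_smul (F := F.obj) (R := K) (X := ⟨n⟩) (Y := ⟨m⟩) f c
    exact congrArg (fun φ => φ.hom.hom) h

/-! ### The category of quantum polynomial functors -/

variable (q) in
/-- The disjoint union over `d ≥ 0` of the source categories of degree `d`. A functor on it is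
a family, indexed by `d`, of functors on the source categories of degree `d`, and a morphism of
functors is a family of morphisms. -/
abbrev TotalSource : Type := Σ d : ℕ, Source q d

variable (q) in
/-- Such a family belongs to the direct sum over `d ≥ 0` of the categories of homogeneous
quantum polynomial functors of degree `d` : each component is `K`-linear, and all but finitely
many components are zero. -/
def IsQuantumPolynomial : ObjectProperty (TotalSource q ⥤ FGModuleCat.{u} K) := fun F =>
  (∀ d : ℕ, IsKLinear (Sigma.incl d ⋙ F)) ∧
    {d : ℕ | ¬ ∀ X : Source q d, IsZero (F.obj ⟨d, X⟩)}.Finite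

variable (q) in
/-- The category of quantum polynomial functors, the direct sum over `d ≥ 0` of the categories
of homogeneous quantum polynomial functors of degree `d`. -/
abbrev QPFunctor : Type (u + 1) := (IsQuantumPolynomial q).FullSubcategory

/-- The homogeneous component of degree `d`. -/
def QPFunctor.component (A : QPFunctor q) (d : ℕ) : HomogFunctor q d :=
  ⟨Sigma.incl d ⋙ A.obj, A.property.1 d⟩

/-- `α` is a weight of the homogeneous functor `F` of degree `d` : the weight space
`F(n)_α = ξ_α F(n)` is nonzero. (If the sum of `α` is not `d`, then `ξ_α = 0`.) -/
def HomogFunctor.IsWeight {d : ℕ} (F : HomogFunctor q d) (n : ℕ+) (α : Fin n → ℕ) : Prop :=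
  LinearMap.range (F.act n n (xi q n d α)) ≠ ⊥

/-- The composition `α` of length `n` is a weight of the quantum polynomial functor `A`. -/
def QPFunctor.IsWeight (A : QPFunctor q) (n : ℕ+) (α : Fin n → ℕ) : Prop :=
  ∃ d : ℕ, (A.component d).IsWeight n α

theorem isKLinear_of_jointly_mono {d : ℕ} {ι : Type*} {F : Source q d ⥤ FGModuleCat.{u} K}
    {G : ι → Source q d ⥤ FGModuleCat.{u} K} (f : ∀ j, F ⟶ G j)
    (hf : ∀ (X Y : Source q d) (a b : F.obj X ⟶ F.obj Y),
      (∀ j, a ≫ (f j).app Y = b ≫ (f j).app Y) → a = b)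
    (hG : ∀ j, IsKLinear (G j)) : IsKLinear F := by
  refine ⟨⟨?_⟩, ⟨?_⟩⟩
  · intro X Y a b
    refine hf X Y _ _ fun j => ?_
    have := (hG j).1
    simp [Functor.map_add, Preadditive.comp_add, Preadditive.add_comp]
  · intro X Y a c
    refine hf X Y _ _ fun j => ?_
    have := (hG j).2
    simp [Functor.map_smul]

theorem isKLinear_of_epi {d : ℕ} {F G : Source q d ⥤ FGModuleCat.{u} K} (f : F ⟶ G)
    [∀ X, Epi (f.app X)] (hF : IsKLinear F) : IsKLinear G := by
  have := hF.1
  have := hF.2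
  refine ⟨⟨?_⟩, ⟨?_⟩⟩
  · intro X Y a b
    rw [← cancel_epi (f.app X)]
    simp [← NatTrans.naturality, Functor.map_add, Preadditive.comp_add, Preadditive.add_comp]
  · intro X Y a c
    rw [← cancel_epi (f.app X)]
    simp [← NatTrans.naturality, Functor.map_smul]

instance : (IsQuantumPolynomial q).IsClosedUnderSubobjects where
  prop_of_mono {F G} f _ hG := by
    refine ⟨fun d => ?_, hG.2.subset ?_⟩
    · exact isKLinear_of_jointly_mono (ι := Unit) (fun _ => Functor.whiskerLeft (Sigma.incl d) f)
        (fun X Y a b h => (cancel_mono (f.app ⟨d, Y⟩)).1 (h ())) fun _ => hG.1 d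
    · intro d hd h
      exact hd fun X => IsZero.of_mono (f.app _) (h X)

instance : (IsQuantumPolynomial q).IsClosedUnderQuotients where
  prop_of_epi {F G} f _ hF := by
    refine ⟨fun d => ?_, hF.2.subset ?_⟩
    · have : ∀ X, Epi ((Functor.whiskerLeft (Sigma.incl d) f).app X) := fun X =>
        inferInstanceAs (Epi (f.app _))
      exact isKLinear_of_epi (Functor.whiskerLeft (Sigma.incl d) f) (hF.1 d)
    · intro d hd h
      exact hd fun X => IsZero.of_epi (f.app _) (h X)

theorem isKLinear_of_forall_isZero {d : ℕ} {F : Source q d ⥤ FGModuleCat.{u} K}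
    (h : ∀ X, IsZero (F.obj X)) : IsKLinear F :=
  ⟨⟨fun {_ Y _ _} => (h Y).eq_of_tgt _ _⟩, ⟨fun {_ Y} _ _ => (h Y).eq_of_tgt _ _⟩⟩

instance : (IsQuantumPolynomial q).ContainsZero where
  exists_zero := by
    refine ⟨_, isZero_zero (TotalSource q ⥤ FGModuleCat.{u} K), ?_⟩
    have h := fun X => ((isZero_zero (TotalSource q ⥤ FGModuleCat.{u} K)).obj X)
    refine ⟨fun d => isKLinear_of_forall_isZero fun X => h _, ?_⟩
    refine Set.finite_empty.subset ?_
    intro d hd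
    exact hd fun X => h _

instance : (IsQuantumPolynomial q).IsClosedUnderBinaryProducts where
  limitsOfShape_le := by
    rintro F ⟨p⟩
    have hl : ∀ X, IsLimit (((evaluation _ _).obj X).mapCone p.cone) := fun X =>
      isLimitOfPreserves ((evaluation _ _).obj X) p.isLimit
    have hj := p.prop_diag_obj
    refine ⟨fun d => ?_, ?_⟩
    · exact isKLinear_of_jointly_mono (fun j => Functor.whiskerLeft (Sigma.incl d) (p.π.app j))
        (fun X Y a b h => (hl ⟨d, Y⟩).hom_ext h) fun j => (hj j).1 d
    · refine ((hj ⟨.left⟩).2.union (hj ⟨.right⟩).2).subset ?_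
      intro d hd
      by_contra hc
      simp only [Set.mem_union, Set.mem_ofPred_eq, not_or, not_not] at hc
      refine hd fun X => ?_
      rw [IsZero.iff_id_eq_zero]
      refine (hl ⟨d, X⟩).hom_ext fun j => ?_
      rcases j with ⟨_ | _⟩
      · exact (hc.1 X).eq_of_tgt _ _
      · exact (hc.2 X).eq_of_tgt _ _

instance : (IsQuantumPolynomial q).IsClosedUnderFiniteProducts :=
  ObjectProperty.IsClosedUnderFiniteProducts.mk'

instance : Abelian (QPFunctor q) := inferInstance

instance : HasExt.{u + 1} (QPFunctor q) := HasExt.standard _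

/-! ### Tensor products and homogeneous functors -/

theorem HomogFunctor.act_id {d : ℕ} (F : HomogFunctor q d) (n : ℕ+) :
    F.act n n (schurId q n d) = LinearMap.id :=
  congrArg (fun φ => φ.hom.hom) (F.obj.map_id ⟨n⟩)

theorem HomogFunctor.act_comp {d : ℕ} (F : HomogFunctor q d) (n r m : ℕ+)
    (g : schur q r m d) (f : schur q n r d) :
    F.act n m (schurComp g f) = F.act r m g ∘ₗ F.act n r f :=
  congrArg (fun φ => φ.hom.hom) (F.obj.map_comp (X := ⟨n⟩) (Y := ⟨r⟩) (Z := ⟨m⟩) f g)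

/-- The map sending `f₁ ⊗ f₂` to `F(f₁) ⊗ G(f₂)`. -/
def tensorAct {d₁ d₂ : ℕ} (F : HomogFunctor q d₁) (G : HomogFunctor q d₂) (n m : ℕ+) :
    schur q n m d₁ ⊗[K] schur q n m d₂ →ₗ[K]
      (F.val n ⊗[K] G.val n →ₗ[K] F.val m ⊗[K] G.val m) :=
  TensorProduct.homTensorHomMap (.id K) _ _ _ _ ∘ₗ TensorProduct.map (F.act n m) (G.act n m)

@[simp]
theorem tensorAct_tmul {d₁ d₂ : ℕ} (F : HomogFunctor q d₁) (G : HomogFunctor q d₂) (n m : ℕ+)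
    (f₁ : schur q n m d₁) (f₂ : schur q n m d₂) :
    tensorAct F G n m (f₁ ⊗ₜ f₂) = TensorProduct.map (F.act n m f₁) (G.act n m f₂) := rfl

theorem tensorAct_schurId {d₁ d₂ : ℕ} (F : HomogFunctor q d₁) (G : HomogFunctor q d₂) (n : ℕ+) :
    tensorAct F G n n (schurComul q n n d₁ d₂ (schurId q n (d₁ + d₂))) = LinearMap.id := by
  have : schurComul q n n d₁ d₂ (schurId q n (d₁ + d₂)) =
      schurId q n d₁ ⊗ₜ schurId q n d₂ := by
    apply schurTensor_injective
    rw [schurTensor_schurComul]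
    refine TensorProduct.ext' fun x y => ?_
    simp [schurId]
  rw [this, tensorAct_tmul, F.act_id, G.act_id, TensorProduct.map_id]

theorem exists_schurTensor_comp {d₁ d₂ : ℕ} (F : HomogFunctor q d₁) (G : HomogFunctor q d₂)
    (n r m : ℕ+) (y : schur q r m d₁ ⊗[K] schur q r m d₂)
    (x : schur q n r d₁ ⊗[K] schur q n r d₂) :
    ∃ z, schurTensor q n m d₁ d₂ z = schurTensor q r m d₁ d₂ y ∘ₗ schurTensor q n r d₁ d₂ x ∧
      tensorAct F G n m z = tensorAct F G r m y ∘ₗ tensorAct F G n r x := by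
  induction y with
  | zero => exact ⟨0, by simp, by simp⟩
  | add y y' hy hy' =>
    obtain ⟨z, h₁, h₂⟩ := hy
    obtain ⟨z', h₁', h₂'⟩ := hy'
    exact ⟨z + z', by rw [map_add, map_add, h₁, h₁', LinearMap.add_comp],
      by rw [map_add, map_add, h₂, h₂', LinearMap.add_comp]⟩
  | tmul g₁ g₂ =>
    induction x with
    | zero => exact ⟨0, by simp, by simp⟩
    | add x x' hx hx' =>
      obtain ⟨z, h₁, h₂⟩ := hx
      obtain ⟨z', h₁', h₂'⟩ := hx'
      exact ⟨z + z', by rw [map_add, map_add, h₁, h₁', LinearMap.comp_add],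
        by rw [map_add, map_add, h₂, h₂', LinearMap.comp_add]⟩
    | tmul f₁ f₂ =>
      refine ⟨schurComp g₁ f₁ ⊗ₜ schurComp g₂ f₂, ?_, ?_⟩
      · simp only [schurTensor_tmul, schurComp, TensorProduct.map_comp]
      · simp only [tensorAct_tmul, HomogFunctor.act_comp, TensorProduct.map_comp]

theorem tensorAct_schurComp {d₁ d₂ : ℕ} (F : HomogFunctor q d₁) (G : HomogFunctor q d₂)
    (n r m : ℕ+) (g : schur q r m (d₁ + d₂)) (f : schur q n r (d₁ + d₂)) :
    tensorAct F G n m (schurComul q n m d₁ d₂ (schurComp g f)) =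
      tensorAct F G r m (schurComul q r m d₁ d₂ g) ∘ₗ
        tensorAct F G n r (schurComul q n r d₁ d₂ f) := by
  obtain ⟨z, h₁, h₂⟩ := exists_schurTensor_comp F G n r m
    (schurComul q r m d₁ d₂ g) (schurComul q n r d₁ d₂ f)
  have : schurComul q n m d₁ d₂ (schurComp g f) = z := by
    apply schurTensor_injective
    rw [h₁, schurTensor_schurComul, schurTensor_schurComul, schurTensor_schurComul]
    refine LinearMap.ext fun x => ?_
    simp [schurComp]
  rw [this, h₂]

/-- The tensor product `F ⊗ G` of homogeneous quantum polynomial functors: its value at `n` is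
`F(n) ⊗ G(n)`, and `(F ⊗ G)(f) = ∑ F(f₁) ⊗ G(f₂)` where `Δ(f) = ∑ f₁ ⊗ f₂`. -/
def HomogFunctor.tensor {d₁ d₂ : ℕ} (F : HomogFunctor q d₁) (G : HomogFunctor q d₂) :
    HomogFunctor q (d₁ + d₂) where
  obj :=
    { obj := fun X => FGModuleCat.of K (F.val X.rank ⊗[K] G.val X.rank)
      map := fun {X Y} f => FGModuleCat.ofHom
        (tensorAct F G X.rank Y.rank (schurComul q X.rank Y.rank d₁ d₂ f))
      map_id := fun X => FGModuleCat.hom_ext (tensorAct_schurId F G X.rank)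
      map_comp := fun {X Y Z} f g =>
        FGModuleCat.hom_ext (tensorAct_schurComp F G X.rank Y.rank Z.rank g f) }
  property := by
    refine ⟨⟨fun {X Y f g} => FGModuleCat.hom_ext ?_⟩, ⟨fun {X Y} f c => FGModuleCat.hom_ext ?_⟩⟩
    · exact (congrArg (tensorAct F G X.rank Y.rank)
        ((schurComul q X.rank Y.rank d₁ d₂).map_add f g)).trans (map_add _ _ _)
    · exact (congrArg (tensorAct F G X.rank Y.rank)
        ((schurComul q X.rank Y.rank d₁ d₂).map_smul c f)).trans (map_smul _ _ _)

/-- The sum `d_0 + (d_1 + (⋯ + d_k))`. -/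
def totalDegree : (k : ℕ) → (Fin (k + 1) → ℕ) → ℕ
  | 0, d => d 0
  | k + 1, d => d 0 + totalDegree k fun i => d i.succ

/-- The tensor product `F_0 ⊗ (F_1 ⊗ (⋯ ⊗ F_k))`. -/
def tensorAll : (k : ℕ) → (d : Fin (k + 1) → ℕ) → ((i : Fin (k + 1)) → HomogFunctor q (d i)) →
    HomogFunctor q (totalDegree k d)
  | 0, _, F => F 0
  | k + 1, d, F => (F 0).tensor (tensorAll k (fun i => d i.succ) fun i => F i.succ)

/-- A homogeneous functor of degree `d` as a quantum polynomial functor: its component of degree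
`d` is `F`, and its other components are zero. -/
def HomogFunctor.toQP {d : ℕ} (F : HomogFunctor q d) : QPFunctor q where
  obj := Sigma.desc
    (Function.update (fun e => (Functor.const (Source q e)).obj (FGModuleCat.of K PUnit.{u + 1}))
      d F.obj)
  property := by
    have hz : IsZero (FGModuleCat.of K PUnit.{u + 1}) := by
      rw [IsZero.iff_id_eq_zero]
      exact FGModuleCat.hom_ext (LinearMap.ext fun _ => rfl)
    refine ⟨fun e => ?_, (Set.finite_singleton d).subset ?_⟩
    · change IsKLinear (Function.update (fun e => (Functor.const (Source q e)).obj
        (FGModuleCat.of K PUnit.{u + 1})) d F.obj e)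
      by_cases h : e = d
      · subst h
        rw [Function.update_self]
        exact F.property
      · rw [Function.update_of_ne h]
        exact isKLinear_of_forall_isZero fun _ => hz
    · intro e he
      by_contra h
      refine he fun X => ?_
      change IsZero ((Function.update (fun e => (Functor.const (Source q e)).obj
        (FGModuleCat.of K PUnit.{u + 1})) d F.obj e).obj X)
      rw [Function.update_of_ne h]
      exact hz

end Functors

end QuantumFunctor

end

/-!
Let `T` be the endofunctor `A ↦ A((k + 1) n)` of the category of quantum polynomial functors. A
Hecke linear map into `V_{(k + 1) n}^{⊗ d}` is determined by its components on the sorted words of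
`k + 1` blocks, so declaring the component on a sorted word to be the identity if every block
occurs, and zero otherwise, defines a natural transformation `η : 1 → T`. Its values lie in weight
spaces with at least `k + 1` nonzero parts, so `η` vanishes at `A`. At `F_1 ⊗ ⋯ ⊗ F_{k+1}` it is a
split monomorphism: the projection onto the word of blocks in which the `i`-th block occurs
`deg F_i` times acts on the tensor product although it is linear over a parabolic subalgebra only,
and it retracts `η`. As `T` is exact, `Ext(A, η) = T(-) ∘ η_A = 0` is injective on
`Ext(A, F_1 ⊗ ⋯ ⊗ F_{k+1})`.
-/

noncomputable section

namespace QuantumFunctor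

section Ext

universe w v v'

variable {C : Type v} [Category.{v'} C] [Abelian C] (T : C ⥤ C) [T.Additive]

/-! ### Ext groups and natural transformations from the identity -/

/-- A natural transformation from the identity to `T`, applied in each degree of a complex. -/
def complexApp (η : 𝟭 C ⟶ T) (K : CochainComplex C ℤ) :
    K ⟶ (T.mapHomologicalComplex _).obj K :=
  (NatTrans.mapHomologicalComplex η (.up ℤ)).app K

variable {T}

theorem complexApp_naturality (η : 𝟭 C ⟶ T) {K L : CochainComplex C ℤ} (f : K ⟶ L) :
    f ≫ complexApp T η L = complexApp T η K ≫ (T.mapHomologicalComplex _).map f :=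
  (NatTrans.mapHomologicalComplex η (.up ℤ)).naturality f

open DerivedCategory in
theorem Q_hom_eq_zero [HasDerivedCategory.{w} C] [T.PreservesHomology]
    (η : 𝟭 C ⟶ T) {K L : CochainComplex C ℤ} (hK : complexApp T η K = 0)
    (r : (T.mapHomologicalComplex _).obj L ⟶ L) (hr : complexApp T η L ≫ r = 𝟙 L)
    (φ : Q.obj K ⟶ Q.obj L) : φ = 0 := by
  obtain ⟨K', s, hs, f, rfl⟩ := right_fac φ
  have hTs : IsIso (Q.map ((T.mapHomologicalComplex _).map s)) := by
    rw [isIso_Q_map_iff_quasiIso] at hs ⊢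
    infer_instance
  have hK' : Q.map (complexApp T η K') = 0 := by
    rw [← cancel_mono (Q.map ((T.mapHomologicalComplex _).map s)), ← Q.map_comp,
      ← complexApp_naturality, hK, comp_zero, Q.map_zero, zero_comp]
  rw [← Category.comp_id f, ← hr, ← Category.assoc, complexApp_naturality, Category.assoc,
    Q.map_comp, hK', zero_comp, comp_zero]

theorem complexApp_f (η : 𝟭 C ⟶ T) (K : CochainComplex C ℤ) (i : ℤ) :
    (complexApp T η K).f i = η.app (K.X i) := rfl

theorem complexApp_single_eq_zero (η : 𝟭 C ⟶ T) {A : C} (hA : η.app A = 0) (i : ℤ) :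
    complexApp T η ((HomologicalComplex.single C (.up ℤ) i).obj A) = 0 := by
  refine HomologicalComplex.from_single_hom_ext ?_
  have h := η.naturality (HomologicalComplex.singleObjXSelf (.up ℤ) i A).inv
  rw [hA, zero_comp] at h
  rw [complexApp_f, HomologicalComplex.zero_f]
  exact (Iso.cancel_iso_inv_left _ _ _).1 (h.trans comp_zero.symm)

theorem exists_complexApp_single_comp (η : 𝟭 C ⟶ T) {Y : C} (ρ : T.obj Y ⟶ Y)
    (hρ : η.app Y ≫ ρ = 𝟙 Y) (i : ℤ) :
    ∃ r, complexApp T η ((HomologicalComplex.single C (.up ℤ) i).obj Y) ≫ r = 𝟙 _ := by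
  refine ⟨(HomologicalComplex.singleMapHomologicalComplex T (.up ℤ) i).hom.app Y ≫
    (HomologicalComplex.single C (.up ℤ) i).map ρ, HomologicalComplex.from_single_hom_ext ?_⟩
  have conjugated_retraction {X Z : C} (e : X ≅ Y) (e' : Z ≅ T.obj Y) :
      η.app X ≫ (T.map e.hom ≫ e'.inv) ≫ e'.hom ≫ ρ ≫ e.inv = 𝟙 X := by
    rw [Category.assoc, Iso.inv_hom_id_assoc, ← NatTrans.naturality_assoc, reassoc_of% hρ]
    exact e.hom_inv_id
  rw [HomologicalComplex.comp_f, complexApp_f, HomologicalComplex.comp_f,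
    HomologicalComplex.singleMapHomologicalComplex_hom_app_self,
    HomologicalComplex.single_map_f_self]
  exact conjugated_retraction _ _

open DerivedCategory in
theorem subsingleton_ext_of_app_eq_zero [HasExt.{w} C] [T.PreservesHomology] (η : 𝟭 C ⟶ T)
    {A Y : C} (hA : η.app A = 0) (ρ : T.obj Y ⟶ Y) (hρ : η.app Y ≫ ρ = 𝟙 Y) (n : ℕ) :
    Subsingleton (Abelian.Ext A Y n) := by
  let := HasDerivedCategory.standard C
  let shiftIso := ((singleFunctors C).shiftIso (n : ℤ) (-n) 0 (by lia)).app Y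
  obtain ⟨r, hr⟩ := exists_complexApp_single_comp η ρ hρ (-n)
  have hom_eq_zero (φ : (singleFunctor C 0).obj A ⟶ (singleFunctor C (-n)).obj Y) : φ = 0 :=
    Q_hom_eq_zero η (complexApp_single_eq_zero η hA 0) r hr φ
  refine ⟨fun e e' => Abelian.Ext.homEquiv.injective ((cancel_mono shiftIso.hom).1 ?_)⟩
  exact (hom_eq_zero _).trans (hom_eq_zero _).symm

end Ext

section AdjPair

/-! ### The Hecke algebra action on words -/

/-- A pair `val, val + 1` of adjacent positions in words of length `d`; these pairs index the
generators of the Hecke algebra. -/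
@[ext]
structure AdjPair (d : ℕ) where
  val : ℕ
  succ_lt : val + 1 < d

namespace AdjPair

variable {d : ℕ}

/-- The first position of the pair. -/
def left (i : AdjPair d) : Fin d := ⟨i.val, Nat.lt_of_succ_lt i.succ_lt⟩

/-- The second position of the pair. -/
def right (i : AdjPair d) : Fin d := ⟨i.val + 1, i.succ_lt⟩

/-- The permutation exchanging the two positions; precomposition with it is `swapWord`. -/
def swap (i : AdjPair d) : Equiv.Perm (Fin d) := Equiv.swap i.left i.right

/-- The pairs share exactly one position, so that the generators satisfy the braid relation. -/
def Adjacent (i j : AdjPair d) : Prop := i.val + 1 = j.val ∨ j.val + 1 = i.val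

/-- The pairs are disjoint, so that the generators commute. -/
def Distant (i j : AdjPair d) : Prop := i.val + 1 < j.val ∨ j.val + 1 < i.val

/-- The permutation `σ` sends the positions of `i` to those of `j`, in order. -/
def CarriedTo (i : AdjPair d) (σ : Equiv.Perm (Fin d)) (j : AdjPair d) : Prop :=
  σ i.left = j.left ∧ σ i.right = j.right

theorem Adjacent.symm {i j : AdjPair d} (h : i.Adjacent j) : j.Adjacent i := Or.symm h

theorem Distant.symm {i j : AdjPair d} (h : i.Distant j) : j.Distant i := Or.symm h

theorem eq_or_adjacent_or_distant (i j : AdjPair d) : i = j ∨ i.Adjacent j ∨ i.Distant j := by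
  simp only [AdjPair.ext_iff, Adjacent, Distant]
  lia

@[simp]
theorem swap_left (i : AdjPair d) : i.swap i.left = i.right := Equiv.swap_apply_left _ _

@[simp]
theorem swap_right (i : AdjPair d) : i.swap i.right = i.left := Equiv.swap_apply_right _ _

@[simp]
theorem swap_symm (i : AdjPair d) : i.swap.symm = i.swap := Equiv.symm_swap _ _

@[simp]
theorem comp_swap_comp_swap {α : Type*} (i : AdjPair d) (w : Fin d → α) :
    (w ∘ i.swap) ∘ i.swap = w := by
  funext t
  simp [swap]

theorem comp_swap_eq_iff {α : Type*} (i : AdjPair d) {v w : Fin d → α} :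
    v ∘ i.swap = w ↔ v = w ∘ i.swap := by
  constructor <;> rintro rfl <;> rw [comp_swap_comp_swap]

theorem comp_swap_eq_self {α : Type*} (i : AdjPair d) {w : Fin d → α}
    (h : w i.left = w i.right) : w ∘ i.swap = w := by
  rw [swap, Equiv.comp_swap_eq_update, h, Function.update_eq_self, ← h, Function.update_eq_self]

theorem CarriedTo.mul_swap {i j : AdjPair d} {σ : Equiv.Perm (Fin d)} (h : i.CarriedTo σ j) :
    σ * i.swap = j.swap * σ := by
  rw [swap, Equiv.mul_swap_eq_swap_mul, h.1, h.2, swap]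

theorem Distant.carriedTo {i j : AdjPair d} (h : i.Distant j) : i.CarriedTo j.swap i := by
  unfold Distant at h
  constructor <;> refine Equiv.swap_apply_of_ne_of_ne ?_ ?_ <;>
    simp only [left, right, ne_eq, Fin.mk.injEq] <;> lia

theorem Adjacent.carriedTo {i j : AdjPair d} (h : i.Adjacent j) :
    i.CarriedTo (i.swap * j.swap) j := by
  unfold Adjacent at h
  simp only [CarriedTo, Equiv.Perm.mul_apply, swap, Equiv.swap_apply_def, left, right,
    Fin.mk.injEq]
  constructor <;> split_ifs <;> simp only [Fin.mk.injEq] at * <;> lia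

theorem Distant.swap_mul_swap {i j : AdjPair d} (h : i.Distant j) :
    i.swap * j.swap = j.swap * i.swap :=
  h.carriedTo.mul_swap.symm

theorem left_eq_right_of_succ {i j : AdjPair d} (h : i.val + 1 = j.val) : j.left = i.right :=
  Fin.ext h.symm

theorem swap_left_of_succ {i j : AdjPair d} (h : i.val + 1 = j.val) : j.swap i.left = i.left := by
  refine Equiv.swap_apply_of_ne_of_ne ?_ ?_ <;> simp only [left, right, ne_eq, Fin.mk.injEq] <;> lia

theorem swap_right_of_succ {i j : AdjPair d} (h : i.val + 1 = j.val) :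
    i.swap j.right = j.right := by
  refine Equiv.swap_apply_of_ne_of_ne ?_ ?_ <;> simp only [left, right, ne_eq, Fin.mk.injEq] <;> lia

theorem Adjacent.lt_comp_swap {α : Type*} [Preorder α] {i j : AdjPair d} (h : i.Adjacent j)
    {w : Fin d → α} (hi : w i.right ≤ w i.left) (hj : w j.right < w j.left) :
    w (j.swap i.right) < w (j.swap i.left) := by
  rcases h with h | h
  · rw [swap_left_of_succ h, ← left_eq_right_of_succ h, swap_left]
    rw [← left_eq_right_of_succ h] at hi
    exact hj.trans_le hi
  · rw [swap_right_of_succ h, left_eq_right_of_succ h, swap_right]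
    rw [left_eq_right_of_succ h] at hi
    exact hi.trans_lt hj

theorem Adjacent.swap_mul_swap_mul_swap {i j : AdjPair d} (h : i.Adjacent j) :
    i.swap * j.swap * i.swap = j.swap * i.swap * j.swap :=
  h.carriedTo.mul_swap.trans (mul_assoc _ _ _).symm

end AdjPair

end AdjPair

section HeckeRelations

variable {K : Type u} [Field K]

/-- The operators `T i` satisfy the quadratic, commutation and braid relations of the generators
of the Hecke algebra, so that they define an action of it on `M`. -/
structure IsHeckeAction (q : K) {M : Type*} [AddCommGroup M] [Module K M] {d : ℕ}
    (T : AdjPair d → Module.End K M) : Prop where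
  quadratic (i : AdjPair d) (x : M) : T i (T i x) = (q - q⁻¹) • T i x + x
  comm {i j : AdjPair d} (h : i.Distant j) (x : M) : T i (T j x) = T j (T i x)
  braid {i j : AdjPair d} (h : i.Adjacent j) (x : M) : T i (T j (T i x)) = T j (T i (T j x))

/-- The operator `heckeT`, indexed by the pair of positions on which it acts. -/
def hecke (q : K) (n : ℕ) {d : ℕ} (i : AdjPair d) : Module.End K (TensorSpace K n d) :=
  heckeT q n d i.val i.succ_lt

/-- The coefficient of `e_a ⊗ e_b` in `R_n (e_a ⊗ e_b)`. -/
def diagCoeff (q : K) {n : ℕ} (a b : Fin n) : K :=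
  if a < b then 0 else if a = b then q else q - q⁻¹

/-- The coefficient of `e_b ⊗ e_a` in `R_n (e_a ⊗ e_b)`, not counting the diagonal entry `q` for
`a = b`. -/
def offDiagCoeff (K : Type u) [Field K] {n : ℕ} (a b : Fin n) : K := if a = b then 0 else 1

variable {q : K} {n d : ℕ}

theorem hecke_wordBasis (i : AdjPair d) (w : Fin d → Fin n) :
    hecke q n i (wordBasis K n d w) =
      diagCoeff q (w i.left) (w i.right) • wordBasis K n d w +
        offDiagCoeff K (w i.left) (w i.right) • wordBasis K n d (w ∘ i.swap) := by
  refine (Module.Basis.constr_basis ..).trans ?_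
  change (if w i.left < w i.right then wordBasis K n d (w ∘ i.swap)
    else if w i.left = w i.right then q • wordBasis K n d (w ∘ i.swap)
    else (q - q⁻¹) • wordBasis K n d w + wordBasis K n d (w ∘ i.swap)) = _
  unfold diagCoeff offDiagCoeff
  rcases lt_trichotomy (w i.left) (w i.right) with h | h | h
  · simp [h, h.ne]
  · rw [i.comp_swap_eq_self h]
    simp [h]
  · simp [h.not_gt, h.ne']

theorem hecke_hecke (hq : q ≠ 0) (i : AdjPair d) (x : TensorSpace K n d) :
    hecke q n i (hecke q n i x) = (q - q⁻¹) • hecke q n i x + x := by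
  suffices hecke q n i ∘ₗ hecke q n i = (q - q⁻¹) • hecke q n i + LinearMap.id from
    LinearMap.congr_fun this x
  refine (wordBasis K n d).ext fun w => ?_
  simp only [LinearMap.comp_apply, LinearMap.add_apply, LinearMap.smul_apply, LinearMap.id_apply,
    hecke_wordBasis, map_add, map_smul, Function.comp_apply, AdjPair.swap_left,
    AdjPair.swap_right, AdjPair.comp_swap_comp_swap, diagCoeff, offDiagCoeff]
  rcases lt_trichotomy (w i.left) (w i.right) with h | h | h
  · simp [h, h.not_gt, h.ne, h.ne']
  · simp only [h, lt_irrefl, if_true, if_false]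
    match_scalars <;> field_simp <;> ring
  · simp [h, h.not_gt, h.ne, h.ne']

theorem hecke_comm {i j : AdjPair d} (h : i.Distant j) (x : TensorSpace K n d) :
    hecke q n i (hecke q n j x) = hecke q n j (hecke q n i x) := by
  suffices hecke q n i ∘ₗ hecke q n j = hecke q n j ∘ₗ hecke q n i from
    LinearMap.congr_fun this x
  refine (wordBasis K n d).ext fun w => ?_
  have swap_swap : (w ∘ i.swap) ∘ j.swap = (w ∘ j.swap) ∘ i.swap :=
    congrArg (fun σ : Equiv.Perm (Fin d) => w ∘ σ) h.swap_mul_swap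
  simp only [LinearMap.comp_apply, hecke_wordBasis, map_add, map_smul, Function.comp_apply,
    h.carriedTo.1, h.carriedTo.2, h.symm.carriedTo.1, h.symm.carriedTo.2, swap_swap]
  module

theorem hecke_braid (hq : q ≠ 0) {i j : AdjPair d} (hij : i.Adjacent j) (x : TensorSpace K n d) :
    hecke q n i (hecke q n j (hecke q n i x)) = hecke q n j (hecke q n i (hecke q n j x)) := by
  wlog h : i.val + 1 = j.val generalizing i j
  · exact (this hij.symm (hij.resolve_left h)).symm
  suffices hecke q n i ∘ₗ hecke q n j ∘ₗ hecke q n i =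
      hecke q n j ∘ₗ hecke q n i ∘ₗ hecke q n j from LinearMap.congr_fun this x
  refine (wordBasis K n d).ext fun w => ?_
  have shared := AdjPair.left_eq_right_of_succ h
  have swap_shared : j.swap i.right = j.right := by rw [← shared, j.swap_left]
  have swap_swap_swap : ((w ∘ i.swap) ∘ j.swap) ∘ i.swap = ((w ∘ j.swap) ∘ i.swap) ∘ j.swap :=
    congrArg (fun σ : Equiv.Perm (Fin d) => w ∘ σ) hij.swap_mul_swap_mul_swap
  simp only [LinearMap.comp_apply, hecke_wordBasis, map_add, map_smul, Function.comp_apply,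
    AdjPair.swap_left, AdjPair.swap_right, AdjPair.comp_swap_comp_swap, shared, swap_shared,
    AdjPair.swap_left_of_succ h, AdjPair.swap_right_of_succ h, swap_swap_swap]
  generalize w i.left = a, w i.right = b, w j.right = c
  unfold diagCoeff offDiagCoeff
  rcases lt_trichotomy a b with hab | hab | hab <;>
    rcases lt_trichotomy b c with hbc | hbc | hbc <;>
    rcases lt_trichotomy a c with hac | hac | hac <;>
    first
    | exact absurd hac (by lia)
    | (simp only [*, lt_irrefl, if_true, if_false, lt_asymm, ne_of_gt, ne_of_lt]
       match_scalars <;> field_simp <;> ring)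

theorem isHeckeAction_hecke (hq : q ≠ 0) : IsHeckeAction q (hecke q n (d := d)) where
  quadratic := hecke_hecke hq
  comm := hecke_comm
  braid := hecke_braid hq

/-! ### Permutations of the tensor factors -/

/-- The left action of the permutations of the positions on `V_n^{⊗ d}`. -/
def perm (K : Type u) [Field K] (n : ℕ) {d : ℕ} (σ : Equiv.Perm (Fin d)) :
    Module.End K (TensorSpace K n d) :=
  (wordBasis K n d).constr K fun w => wordBasis K n d (w ∘ σ.symm)

theorem perm_wordBasis (σ : Equiv.Perm (Fin d)) (w : Fin d → Fin n) :
    perm K n σ (wordBasis K n d w) = wordBasis K n d (w ∘ σ.symm) :=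
  Module.Basis.constr_basis ..

theorem perm_mul (σ τ : Equiv.Perm (Fin d)) (x : TensorSpace K n d) :
    perm K n (σ * τ) x = perm K n σ (perm K n τ x) := by
  suffices perm K n (σ * τ) = perm K n σ ∘ₗ perm K n τ from LinearMap.congr_fun this x
  refine (wordBasis K n d).ext fun w => ?_
  simp only [LinearMap.comp_apply, perm_wordBasis]
  rfl

theorem perm_swap_perm_swap (i : AdjPair d) (x : TensorSpace K n d) :
    perm K n i.swap (perm K n i.swap x) = x := by
  suffices perm K n i.swap ∘ₗ perm K n i.swap = .id from LinearMap.congr_fun this x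
  refine (wordBasis K n d).ext fun w => ?_
  simp [perm_wordBasis]

theorem hecke_perm {i j : AdjPair d} {σ : Equiv.Perm (Fin d)} (h : i.CarriedTo σ j)
    (x : TensorSpace K n d) :
    hecke q n j (perm K n σ x) = perm K n σ (hecke q n i x) := by
  suffices hecke q n j ∘ₗ perm K n σ = perm K n σ ∘ₗ hecke q n i from LinearMap.congr_fun this x
  refine (wordBasis K n d).ext fun w => ?_
  have swap_comp : (w ∘ σ.symm) ∘ j.swap = (w ∘ i.swap) ∘ σ.symm := by
    have hσ : σ⁻¹ * j.swap = i.swap * σ⁻¹ := by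
      rw [inv_mul_eq_iff_eq_mul, ← mul_assoc, h.mul_swap, mul_inv_cancel_right]
    exact congrArg (fun σ : Equiv.Perm (Fin d) => w ∘ σ) hσ
  have hleft : σ.symm j.left = i.left := by rw [← h.1, Equiv.symm_apply_apply]
  have hright : σ.symm j.right = i.right := by rw [← h.2, Equiv.symm_apply_apply]
  simp only [LinearMap.comp_apply, perm_wordBasis, hecke_wordBasis, map_add, map_smul,
    Function.comp_apply, hleft, hright, swap_comp]

end HeckeRelations

section Blocks

variable {K : Type u} [Field K] {b n d : ℕ}

/-! ### Words in the letters `(block, value)` -/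

/-- The word of blocks of a word in the letters `(block, value)`, where `Fin (b * n)` carries the
lexicographic order of the pairs. -/
def blockWord (w : Fin d → Fin (b * n)) : Fin d → Fin b := fun t => (finProdFinEquiv.symm (w t)).1

/-- The word of values of a word in the letters `(block, value)`. -/
def valueWord (w : Fin d → Fin (b * n)) : Fin d → Fin n := fun t => (finProdFinEquiv.symm (w t)).2

/-- The word with given blocks and values. -/
def joinWord (β : Fin d → Fin b) (v : Fin d → Fin n) : Fin d → Fin (b * n) :=
  fun t => finProdFinEquiv (β t, v t)

@[simp]
theorem blockWord_joinWord (β : Fin d → Fin b) (v : Fin d → Fin n) :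
    blockWord (joinWord β v) = β := by
  funext t
  simp only [blockWord, joinWord, Equiv.symm_apply_apply]

@[simp]
theorem valueWord_joinWord (β : Fin d → Fin b) (v : Fin d → Fin n) :
    valueWord (joinWord β v) = v := by
  funext t
  simp only [valueWord, joinWord, Equiv.symm_apply_apply]

@[simp]
theorem joinWord_blockWord_valueWord (w : Fin d → Fin (b * n)) :
    joinWord (blockWord w) (valueWord w) = w := by
  funext t
  simp only [blockWord, valueWord, joinWord, Prod.mk.eta, Equiv.apply_symm_apply]

theorem finProdFinEquiv_lt_iff (x y : Fin b × Fin n) :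
    finProdFinEquiv x < finProdFinEquiv y ↔ x.1 < y.1 ∨ x.1 = y.1 ∧ x.2 < y.2 := by
  obtain ⟨a, u⟩ := x
  obtain ⟨c, v⟩ := y
  have value_add_lt (a c : Fin b) (u v : Fin n) (h : a < c) : u + n * a < v + n * c := by
    have := Nat.mul_le_mul_left n (Nat.succ_le_of_lt h)
    have := u.2
    lia
  simp only [Fin.lt_def, finProdFinEquiv_apply_val, Fin.ext_iff]
  rcases lt_trichotomy a c with h | rfl | h
  · simpa [h] using value_add_lt a c u v h
  · simp
  · simp [Fin.ext_iff.not.1 h.ne', Fin.lt_def.not.1 h.not_gt, (value_add_lt c a v u h).le]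

theorem diagCoeff_finProdFinEquiv (q : K) (x y : Fin b × Fin n) :
    diagCoeff q (finProdFinEquiv x) (finProdFinEquiv y) =
      if x.1 = y.1 then diagCoeff q x.2 y.2 else diagCoeff q x.1 y.1 := by
  simp only [diagCoeff, finProdFinEquiv_lt_iff, finProdFinEquiv.injective.eq_iff, Prod.ext_iff]
  split_ifs <;> grind

theorem offDiagCoeff_finProdFinEquiv (x y : Fin b × Fin n) :
    offDiagCoeff K (finProdFinEquiv x) (finProdFinEquiv y) =
      if x.1 = y.1 then offDiagCoeff K x.2 y.2 else 1 := by
  simp only [offDiagCoeff, finProdFinEquiv.injective.eq_iff, Prod.ext_iff]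
  split_ifs <;> grind

theorem hecke_joinWord (q : K) (i : AdjPair d) (γ : Fin d → Fin b) (v : Fin d → Fin n) :
    hecke q (b * n) i (wordBasis K (b * n) d (joinWord γ v)) =
      (if γ i.left = γ i.right then diagCoeff q (v i.left) (v i.right)
        else diagCoeff q (γ i.left) (γ i.right)) • wordBasis K (b * n) d (joinWord γ v) +
      (if γ i.left = γ i.right then offDiagCoeff K (v i.left) (v i.right) else 1) •
        wordBasis K (b * n) d (joinWord (γ ∘ i.swap) (v ∘ i.swap)) := by
  rw [hecke_wordBasis]
  simp only [joinWord, diagCoeff_finProdFinEquiv, offDiagCoeff_finProdFinEquiv]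
  rfl

/-- The projection of `V_{bn}^{⊗ d}` onto the span of the words with the word of blocks `β`,
identified with `V_n^{⊗ d}` through the words of values. -/
def blockProj (K : Type u) [Field K] (n : ℕ) (β : Fin d → Fin b) :
    TensorSpace K (b * n) d →ₗ[K] TensorSpace K n d :=
  (wordBasis K (b * n) d).constr K fun w =>
    if blockWord w = β then wordBasis K n d (valueWord w) else 0

/-- The embedding of `V_n^{⊗ d}` in `V_{bn}^{⊗ d}` as the span of the words with the word of
blocks `β`. -/
def blockIncl (K : Type u) [Field K] (n : ℕ) (β : Fin d → Fin b) :
    TensorSpace K n d →ₗ[K] TensorSpace K (b * n) d :=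
  (wordBasis K n d).constr K fun v => wordBasis K (b * n) d (joinWord β v)

theorem blockProj_wordBasis (β : Fin d → Fin b) (w : Fin d → Fin (b * n)) :
    blockProj K n β (wordBasis K (b * n) d w) =
      if blockWord w = β then wordBasis K n d (valueWord w) else 0 :=
  Module.Basis.constr_basis ..

theorem blockIncl_wordBasis (β : Fin d → Fin b) (v : Fin d → Fin n) :
    blockIncl K n β (wordBasis K n d v) = wordBasis K (b * n) d (joinWord β v) :=
  Module.Basis.constr_basis ..

theorem blockProj_blockIncl (β γ : Fin d → Fin b) (x : TensorSpace K n d) :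
    blockProj K n β (blockIncl K n γ x) = if γ = β then x else 0 := by
  have comp_eq : blockProj K n β ∘ₗ blockIncl K n γ = if γ = β then LinearMap.id else 0 := by
    refine (wordBasis K n d).ext fun w => ?_
    rw [LinearMap.comp_apply, blockIncl_wordBasis, blockProj_wordBasis]
    split_ifs <;> simp_all
  have := LinearMap.congr_fun comp_eq x
  split_ifs at this ⊢ <;> exact this

theorem sum_blockIncl_blockProj (x : TensorSpace K (b * n) d) :
    ∑ β : Fin d → Fin b, blockIncl K n β (blockProj K n β x) = x := by
  have sum_eq_id : ∑ β : Fin d → Fin b, blockIncl K n β ∘ₗ blockProj K n β = LinearMap.id := by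
    refine (wordBasis K (b * n) d).ext fun w => ?_
    simp only [LinearMap.sum_apply, LinearMap.comp_apply, blockProj_wordBasis, apply_ite, map_zero,
      blockIncl_wordBasis]
    simp
  simpa using LinearMap.congr_fun sum_eq_id x

theorem ext_blockProj {x y : TensorSpace K (b * n) d}
    (h : ∀ β : Fin d → Fin b, blockProj K n β x = blockProj K n β y) : x = y := by
  rw [← sum_blockIncl_blockProj x, ← sum_blockIncl_blockProj y]
  exact Finset.sum_congr rfl fun β _ => by rw [h β]

theorem ext_joinWord {V : Type*} [AddCommGroup V] [Module K V]
    {f g : TensorSpace K (b * n) d →ₗ[K] V}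
    (h : ∀ (γ : Fin d → Fin b) (v : Fin d → Fin n),
      f (wordBasis K (b * n) d (joinWord γ v)) = g (wordBasis K (b * n) d (joinWord γ v))) :
    f = g := by
  refine (wordBasis K (b * n) d).ext fun w => ?_
  rw [← joinWord_blockWord_valueWord w]
  exact h _ _

theorem blockProj_hecke_of_eq (q : K) {i : AdjPair d} {β : Fin d → Fin b}
    (h : β i.left = β i.right) (x : TensorSpace K (b * n) d) :
    blockProj K n β (hecke q (b * n) i x) = hecke q n i (blockProj K n β x) := by
  suffices blockProj K n β ∘ₗ hecke q (b * n) i = hecke q n i ∘ₗ blockProj K n β from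
    LinearMap.congr_fun this x
  refine ext_joinWord fun γ v => ?_
  have comp_swap_eq : γ ∘ i.swap = β ↔ γ = β := by
    rw [i.comp_swap_eq_iff, i.comp_swap_eq_self h]
  simp only [LinearMap.comp_apply, hecke_joinWord, map_add, map_smul, blockProj_wordBasis,
    blockWord_joinWord, valueWord_joinWord, comp_swap_eq]
  split_ifs with hγ hβ hβ
  · rw [hecke_wordBasis]
  · simp
  · exact absurd (hβ ▸ h) hγ
  · simp

theorem blockProj_hecke_of_ne (q : K) {i : AdjPair d} {β : Fin d → Fin b}
    (h : β i.left ≠ β i.right) (x : TensorSpace K (b * n) d) :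
    blockProj K n β (hecke q (b * n) i x) =
      diagCoeff q (β i.left) (β i.right) • blockProj K n β x +
        perm K n i.swap (blockProj K n (β ∘ i.swap) x) := by
  suffices blockProj K n β ∘ₗ hecke q (b * n) i =
      diagCoeff q (β i.left) (β i.right) • blockProj K n β +
        perm K n i.swap ∘ₗ blockProj K n (β ∘ i.swap) from LinearMap.congr_fun this x
  refine ext_joinWord fun γ v => ?_
  simp only [LinearMap.comp_apply, LinearMap.add_apply, LinearMap.smul_apply, hecke_joinWord,
    map_add, map_smul, blockProj_wordBasis, blockWord_joinWord, valueWord_joinWord]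
  congr 1
  · by_cases hγ : γ = β
    · simp [hγ, h]
    · simp [hγ]
  · simp only [i.comp_swap_eq_iff]
    by_cases hγ : γ = β ∘ i.swap
    · simp [hγ, h.symm, perm_wordBasis]
    · simp [hγ]

/-! ### Sorting words by adjacent exchanges -/

theorem exists_lt_of_not_monotone {β : Fin d → Fin b} (h : ¬ Monotone β) :
    ∃ i : AdjPair d, β i.right < β i.left := by
  by_contra! hβ
  cases d with
  | zero => exact h (Subsingleton.monotone β)
  | succ d =>
    exact h (Fin.monotone_iff_le_succ.2 fun t => hβ ⟨t, Nat.succ_lt_succ t.2⟩)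

theorem AdjPair.left_le_right (i : AdjPair d) : i.left ≤ i.right := Nat.le_succ _

theorem toLex_comp_swap_lt {β : Fin d → Fin b} {i : AdjPair d} (h : β i.right < β i.left) :
    toLex (β ∘ i.swap) < toLex β := by
  refine ⟨i.left, fun t ht => ?_, ?_⟩
  · exact congrArg β (Equiv.swap_apply_of_ne_of_ne ht.ne (ht.trans_le i.left_le_right).ne)
  · change β (i.swap i.left) < β i.left
    rwa [i.swap_left]

theorem lex_induction {P : (Fin d → Fin b) → Prop}
    (h : ∀ β, (∀ γ, toLex γ < toLex β → P γ) → P β) (β : Fin d → Fin b) : P β :=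
  (InvImage.wf (fun β : Fin d → Fin b => toLex β) wellFounded_lt).induction β h

theorem sorting_induction {P : (Fin d → Fin b) → Prop} (monotone : ∀ β, Monotone β → P β)
    (swap : ∀ (β) (i : AdjPair d), β i.right < β i.left → P (β ∘ i.swap) → P β)
    (β : Fin d → Fin b) : P β := by
  induction β using lex_induction with
  | h β ih =>
    by_cases hβ : Monotone β
    · exact monotone β hβ
    · obtain ⟨i, hi⟩ := exists_lt_of_not_monotone hβ
      exact swap β i hi (ih _ (toLex_comp_swap_lt hi))

end Blocks

section Lift

variable {K : Type u} [Field K] {q : K} {M : Type*} [AddCommGroup M] [Module K M] {b n d : ℕ}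
  {T : AdjPair d → Module.End K M}

/-! ### Hecke linear maps with prescribed components on sorted words of blocks -/

/-- The value that the component at the word of blocks `β` must have, for a Hecke linear map with
components `c`, when the letters of `β` at `i` are in the wrong order. -/
def sortStep (T : AdjPair d → Module.End K M)
    (c : (Fin d → Fin b) → M →ₗ[K] TensorSpace K n d) (i : AdjPair d) (β : Fin d → Fin b) :
    M →ₗ[K] TensorSpace K n d :=
  perm K n i.swap ∘ₗ c (β ∘ i.swap) ∘ₗ T i

theorem blockProj_comp_eq_sortStep {f : M →ₗ[K] TensorSpace K (b * n) d}
    (hf : ∀ i x, f (T i x) = hecke q (b * n) i (f x)) {β : Fin d → Fin b} {i : AdjPair d}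
    (h : β i.right < β i.left) :
    blockProj K n β ∘ₗ f = sortStep T (fun γ => blockProj K n γ ∘ₗ f) i β := by
  refine LinearMap.ext fun x => ?_
  have ascent : (β ∘ i.swap) i.left < (β ∘ i.swap) i.right := by simpa using h
  simp only [sortStep, LinearMap.comp_apply, hf]
  rw [blockProj_hecke_of_ne q ascent.ne, diagCoeff, if_pos ascent, zero_smul, zero_add,
    perm_swap_perm_swap, i.comp_swap_comp_swap]

theorem ext_blockProj_of_monotone {f g : M →ₗ[K] TensorSpace K (b * n) d}
    (hf : ∀ i x, f (T i x) = hecke q (b * n) i (f x))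
    (hg : ∀ i x, g (T i x) = hecke q (b * n) i (g x))
    (h : ∀ β : Fin d → Fin b, Monotone β → blockProj K n β ∘ₗ f = blockProj K n β ∘ₗ g) :
    f = g := by
  suffices ∀ β : Fin d → Fin b, blockProj K n β ∘ₗ f = blockProj K n β ∘ₗ g from
    LinearMap.ext fun x => ext_blockProj fun β => LinearMap.congr_fun (this β) x
  intro β
  induction β using sorting_induction with
  | monotone β hβ => exact h β hβ
  | swap β i hi ih =>
    rw [blockProj_comp_eq_sortStep hf hi, blockProj_comp_eq_sortStep hg hi]
    simp only [sortStep, ih]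

section SortStep

variable {c : (Fin d → Fin b) → M →ₗ[K] TensorSpace K n d} {β : Fin d → Fin b} {i j : AdjPair d}

theorem sortStep_eq_of_distant (hT : IsHeckeAction q T) (h : i.Distant j)
    (hi : c (β ∘ i.swap) = sortStep T c j (β ∘ i.swap))
    (hj : c (β ∘ j.swap) = sortStep T c i (β ∘ j.swap)) :
    sortStep T c i β = sortStep T c j β := by
  have comp_swap_swap : (β ∘ i.swap) ∘ j.swap = (β ∘ j.swap) ∘ i.swap :=
    congrArg (fun σ : Equiv.Perm (Fin d) => β ∘ σ) h.swap_mul_swap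
  refine LinearMap.ext fun x => ?_
  rw [sortStep, hi, sortStep, sortStep, hj, sortStep]
  simp only [LinearMap.comp_apply, ← perm_mul]
  rw [comp_swap_swap, h.swap_mul_swap, hT.comm h]

theorem sortStep_eq_of_adjacent (hT : IsHeckeAction q T) (h : i.Adjacent j)
    (hi : c (β ∘ i.swap) = sortStep T c j (β ∘ i.swap))
    (hij : c ((β ∘ i.swap) ∘ j.swap) = sortStep T c i ((β ∘ i.swap) ∘ j.swap))
    (hj : c (β ∘ j.swap) = sortStep T c i (β ∘ j.swap))
    (hji : c ((β ∘ j.swap) ∘ i.swap) = sortStep T c j ((β ∘ j.swap) ∘ i.swap)) :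
    sortStep T c i β = sortStep T c j β := by
  have comp_swap_swap_swap : ((β ∘ i.swap) ∘ j.swap) ∘ i.swap = ((β ∘ j.swap) ∘ i.swap) ∘ j.swap :=
    congrArg (fun σ : Equiv.Perm (Fin d) => β ∘ σ) h.swap_mul_swap_mul_swap
  refine LinearMap.ext fun x => ?_
  rw [sortStep, hi, sortStep, hij, sortStep, sortStep, hj, sortStep, hji, sortStep]
  simp only [LinearMap.comp_apply, ← perm_mul]
  rw [comp_swap_swap_swap, ← mul_assoc, h.swap_mul_swap_mul_swap, hT.braid h, mul_assoc]

theorem map_hecke_of_distant (hT : IsHeckeAction q T) (h : i.Distant j)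
    (hβ : c β = sortStep T c j β)
    (hc : ∀ x, c (β ∘ j.swap) (T i x) = hecke q n i (c (β ∘ j.swap) x)) (x : M) :
    c β (T i x) = hecke q n i (c β x) := by
  simp only [hβ, sortStep, LinearMap.comp_apply]
  rw [hT.comm h.symm, hc, hecke_perm h.carriedTo]

theorem map_hecke_of_adjacent (hT : IsHeckeAction q T) (h : i.Adjacent j)
    (hβ : c β = sortStep T c j β) (hj : c (β ∘ j.swap) = sortStep T c i (β ∘ j.swap))
    (hc : ∀ x, c ((β ∘ j.swap) ∘ i.swap) (T j x) = hecke q n j (c ((β ∘ j.swap) ∘ i.swap) x))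
    (x : M) :
    c β (T i x) = hecke q n i (c β x) := by
  rw [hβ, sortStep, hj, sortStep]
  simp only [LinearMap.comp_apply, ← perm_mul]
  rw [hT.braid h, hc, hecke_perm h.symm.carriedTo]

end SortStep

/-- The components of the Hecke linear map with components `φ` on sorted words of blocks. An
unsorted word is sorted by `sortStep` at an arbitrarily chosen descent. -/
def liftComp (T : AdjPair d → Module.End K M)
    (φ : (Fin d → Fin b) → M →ₗ[K] TensorSpace K n d) :
    (Fin d → Fin b) → M →ₗ[K] TensorSpace K n d :=
  (InvImage.wf (fun β : Fin d → Fin b => toLex β) wellFounded_lt).fix fun β sorted =>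
    open Classical in
    if h : ∃ i : AdjPair d, β i.right < β i.left then
      perm K n h.choose.swap ∘ₗ
        sorted (β ∘ h.choose.swap) (toLex_comp_swap_lt h.choose_spec) ∘ₗ T h.choose
    else φ β

variable {φ : (Fin d → Fin b) → M →ₗ[K] TensorSpace K n d}

theorem liftComp_of_monotone {β : Fin d → Fin b} (h : Monotone β) : liftComp T φ β = φ β := by
  rw [liftComp, WellFounded.fix_eq, dif_neg]
  rintro ⟨i, hi⟩
  exact hi.not_ge (h i.left_le_right)

theorem exists_liftComp_eq_sortStep {β : Fin d → Fin b} (h : ¬ Monotone β) :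
    ∃ i : AdjPair d, β i.right < β i.left ∧ liftComp T φ β = sortStep T (liftComp T φ) i β := by
  have descent := exists_lt_of_not_monotone h
  refine ⟨descent.choose, descent.choose_spec, ?_⟩
  rw [liftComp, WellFounded.fix_eq, dif_pos descent]
  rfl

theorem liftComp_eq_sortStep (hT : IsHeckeAction q T) {β : Fin d → Fin b} {i : AdjPair d}
    (h : β i.right < β i.left) : liftComp T φ β = sortStep T (liftComp T φ) i β := by
  induction β using lex_induction generalizing i with
  | h β ih =>
    obtain ⟨j, hj, hβ⟩ := exists_liftComp_eq_sortStep (T := T) (φ := φ) (β := β)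
      fun hβ => h.not_ge (hβ i.left_le_right)
    have ih_swap {i j : AdjPair d} (hi : β i.right < β i.left)
        (hj : β (i.swap j.right) < β (i.swap j.left)) :
        liftComp T φ (β ∘ i.swap) = sortStep T (liftComp T φ) j (β ∘ i.swap) :=
      ih _ (toLex_comp_swap_lt hi) hj
    have ih_swap_swap {i j : AdjPair d} (hij : i.Adjacent j) (hi : β i.right < β i.left)
        (hj : β j.right < β j.left) :
        liftComp T φ ((β ∘ i.swap) ∘ j.swap) =
          sortStep T (liftComp T φ) i ((β ∘ i.swap) ∘ j.swap) := by
      refine ih _ ((toLex_comp_swap_lt ?_).trans (toLex_comp_swap_lt hi)) ?_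
      · exact hij.symm.lt_comp_swap hj.le hi
      · rwa [← hij.carriedTo.1, ← hij.carriedTo.2] at hj
    rcases i.eq_or_adjacent_or_distant j with rfl | hij | hij
    · exact hβ
    · rw [hβ]
      exact (sortStep_eq_of_adjacent hT hij (ih_swap h (hij.symm.lt_comp_swap hj.le h))
        (ih_swap_swap hij h hj) (ih_swap hj (hij.lt_comp_swap h.le hj))
        (ih_swap_swap hij.symm hj h)).symm
    · rw [hβ]
      refine (sortStep_eq_of_distant hT hij (ih_swap h ?_) (ih_swap hj ?_)).symm
      · rwa [hij.symm.carriedTo.1, hij.symm.carriedTo.2]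
      · rwa [hij.carriedTo.1, hij.carriedTo.2]

/-- The component `φ β` at a sorted word `β` is linear over the parabolic subalgebra generated by
the pairs of positions on which `β` is constant. -/
def IsParabolicLinear (q : K) (T : AdjPair d → Module.End K M)
    (φ : (Fin d → Fin b) → M →ₗ[K] TensorSpace K n d) : Prop :=
  ∀ β, Monotone β → ∀ i : AdjPair d, β i.left = β i.right →
    ∀ x, φ β (T i x) = hecke q n i (φ β x)

theorem liftComp_hecke_of_eq (hT : IsHeckeAction q T) (hφ : IsParabolicLinear q T φ)
    {β : Fin d → Fin b} {i : AdjPair d} (h : β i.left = β i.right) (x : M) :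
    liftComp T φ β (T i x) = hecke q n i (liftComp T φ β x) := by
  induction β using lex_induction generalizing i x with
  | h β ih =>
    by_cases hβ : Monotone β
    · rw [liftComp_of_monotone hβ, hφ β hβ i h]
    obtain ⟨j, hj, hβ⟩ := exists_liftComp_eq_sortStep (T := T) (φ := φ) hβ
    have lt := toLex_comp_swap_lt hj
    rcases i.eq_or_adjacent_or_distant j with rfl | hij | hij
    · exact absurd h hj.ne'
    · have hi := hij.lt_comp_swap h.ge hj
      refine map_hecke_of_adjacent hT hij hβ (liftComp_eq_sortStep hT hi)
        (ih _ ((toLex_comp_swap_lt hi).trans lt) ?_) x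
      rwa [← hij.symm.carriedTo.1, ← hij.symm.carriedTo.2] at h
    · refine map_hecke_of_distant hT hij hβ (ih _ lt ?_) x
      rwa [← hij.carriedTo.1, ← hij.carriedTo.2] at h

/-- The Hecke linear map with components `φ` on sorted words of blocks. -/
def lift (T : AdjPair d → Module.End K M) (φ : (Fin d → Fin b) → M →ₗ[K] TensorSpace K n d) :
    M →ₗ[K] TensorSpace K (b * n) d :=
  ∑ β : Fin d → Fin b, blockIncl K n β ∘ₗ liftComp T φ β

theorem blockProj_lift (β : Fin d → Fin b) (x : M) :
    blockProj K n β (lift T φ x) = liftComp T φ β x := by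
  simp [lift, LinearMap.sum_apply, blockProj_blockIncl]

theorem lift_hecke (hT : IsHeckeAction q T) (hφ : IsParabolicLinear q T φ) (i : AdjPair d)
    (x : M) : lift T φ (T i x) = hecke q (b * n) i (lift T φ x) := by
  refine ext_blockProj fun β => ?_
  have swap_back (h : β i.right < β i.left) (x : M) :
      perm K n i.swap (liftComp T φ (β ∘ i.swap) (T i x)) = liftComp T φ β x := by
    rw [liftComp_eq_sortStep hT h]
    rfl
  rcases lt_trichotomy (β i.left) (β i.right) with h | h | h
  · have descent : (β ∘ i.swap) i.right < (β ∘ i.swap) i.left := by simpa using h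
    simp only [blockProj_hecke_of_ne q h.ne, diagCoeff, if_pos h, zero_smul, zero_add,
      blockProj_lift]
    rw [liftComp_eq_sortStep hT descent, sortStep, i.comp_swap_comp_swap]
    exact (perm_swap_perm_swap i _).symm
  · rw [blockProj_hecke_of_eq q h, blockProj_lift, blockProj_lift, liftComp_hecke_of_eq hT hφ h]
  · simp only [blockProj_hecke_of_ne q h.ne', diagCoeff, if_neg h.not_gt, if_neg h.ne',
      blockProj_lift]
    rw [← swap_back h, hT.quadratic, map_add, map_add, map_smul, map_smul, swap_back h]

end Lift

section BlowUp

variable {K : Type u} [Field K] {q : K} {b n m r d : ℕ}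

/-! ### Replacing `V_n` by the sum of `b` copies of `V_n` -/

theorem schur_map_hecke (f : schur q n m d) (i : AdjPair d) (x : TensorSpace K n d) :
    f.1 (hecke q n i x) = hecke q m i (f.1 x) :=
  LinearMap.congr_fun (f.2 i.val i.succ_lt) x

theorem schur_ext_of_monotone {f g : schur q n (b * m) d}
    (h : ∀ β : Fin d → Fin b, Monotone β → blockProj K m β ∘ₗ f.1 = blockProj K m β ∘ₗ g.1) :
    f = g :=
  Subtype.ext (ext_blockProj_of_monotone (schur_map_hecke f) (schur_map_hecke g) h)

/-- The Hecke linear map `V_n^{⊗ d} → V_{b m}^{⊗ d}` with components `φ` on sorted words of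
blocks. -/
def liftSchur (hq : q ≠ 0) (φ : (Fin d → Fin b) → TensorSpace K n d →ₗ[K] TensorSpace K m d)
    (hφ : IsParabolicLinear q (hecke q n) φ) : schur q n (b * m) d :=
  ⟨lift (hecke q n) φ, fun i hi =>
    LinearMap.ext fun x => lift_hecke (isHeckeAction_hecke hq) hφ ⟨i, hi⟩ x⟩

theorem blockProj_liftSchur (hq : q ≠ 0)
    {φ : (Fin d → Fin b) → TensorSpace K n d →ₗ[K] TensorSpace K m d}
    (hφ : IsParabolicLinear q (hecke q n) φ) {β : Fin d → Fin b} (hβ : Monotone β) :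
    blockProj K m β ∘ₗ (liftSchur hq φ hφ).1 = φ β :=
  LinearMap.ext fun x => by
    rw [LinearMap.comp_apply, liftSchur, blockProj_lift, liftComp_of_monotone hβ]

theorem isParabolicLinear_comp_blockProj (f : schur q n m d) :
    IsParabolicLinear q (hecke q (b * n)) fun β => f.1 ∘ₗ blockProj K n β := by
  intro β _ i h x
  rw [LinearMap.comp_apply, blockProj_hecke_of_eq q h, schur_map_hecke, LinearMap.comp_apply]

/-- The Hecke linear map `V_{b n}^{⊗ d} → V_{b m}^{⊗ d}` that acts by `f` on the values of the
words with a given sorted word of blocks. -/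
def blowUp (hq : q ≠ 0) (b : ℕ) (f : schur q n m d) : schur q (b * n) (b * m) d :=
  liftSchur hq _ (isParabolicLinear_comp_blockProj f)

theorem blockProj_blowUp (hq : q ≠ 0) (f : schur q n m d) {β : Fin d → Fin b}
    (hβ : Monotone β) : blockProj K m β ∘ₗ (blowUp hq b f).1 = f.1 ∘ₗ blockProj K n β :=
  blockProj_liftSchur hq _ hβ

theorem blowUp_id (hq : q ≠ 0) (b n d : ℕ) :
    blowUp hq b (schurId q n d) = schurId q (b * n) d :=
  schur_ext_of_monotone fun _ hβ => blockProj_blowUp hq _ hβ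

theorem blowUp_comp (hq : q ≠ 0) (b : ℕ) (g : schur q r m d) (f : schur q n r d) :
    blowUp hq b (schurComp g f) = schurComp (blowUp hq b g) (blowUp hq b f) :=
  schur_ext_of_monotone fun β hβ => by
    rw [blockProj_blowUp hq _ hβ]
    change g.1 ∘ₗ f.1 ∘ₗ blockProj K n β =
      (blockProj K m β ∘ₗ (blowUp hq b g).1) ∘ₗ (blowUp hq b f).1
    rw [blockProj_blowUp hq g hβ, LinearMap.comp_assoc, blockProj_blowUp hq f hβ]

theorem blowUp_add (hq : q ≠ 0) (b : ℕ) (f g : schur q n m d) :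
    blowUp hq b (f + g) = blowUp hq b f + blowUp hq b g :=
  schur_ext_of_monotone fun _ hβ => by
    simp only [Submodule.coe_add, LinearMap.comp_add, LinearMap.add_comp, blockProj_blowUp hq _ hβ]

theorem blowUp_smul (hq : q ≠ 0) (b : ℕ) (c : K) (f : schur q n m d) :
    blowUp hq b (c • f) = c • blowUp hq b f :=
  schur_ext_of_monotone fun _ hβ => by
    simp only [Submodule.coe_smul, LinearMap.comp_smul, LinearMap.smul_comp,
      blockProj_blowUp hq _ hβ]

open Classical in
/-- The components of `diag` on sorted words of blocks. -/
def diagComp (K : Type u) [Field K] (n : ℕ) (β : Fin d → Fin b) :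
    Module.End K (TensorSpace K n d) :=
  if Function.Surjective β then LinearMap.id else 0

theorem diagComp_of_surjective {β : Fin d → Fin b} (hβ : Function.Surjective β) :
    diagComp K n β = LinearMap.id := if_pos hβ

theorem diagComp_of_not_surjective {β : Fin d → Fin b} (hβ : ¬ Function.Surjective β) :
    diagComp K n β = 0 := if_neg hβ

theorem comp_diagComp (f : TensorSpace K n d →ₗ[K] TensorSpace K m d) (β : Fin d → Fin b) :
    f ∘ₗ diagComp K n β = diagComp K m β ∘ₗ f := by
  by_cases hβ : Function.Surjective β
  · rw [diagComp_of_surjective hβ, diagComp_of_surjective hβ, LinearMap.comp_id, LinearMap.id_comp]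
  · rw [diagComp_of_not_surjective hβ, diagComp_of_not_surjective hβ, LinearMap.comp_zero,
      LinearMap.zero_comp]

theorem isParabolicLinear_diagComp (q : K) (b n d : ℕ) :
    IsParabolicLinear q (hecke q n) (diagComp K n (b := b) (d := d)) :=
  fun β _ i _ x => (LinearMap.congr_fun (comp_diagComp (hecke q n i) β) x).symm

/-- The Hecke linear map `V_n^{⊗ d} → V_{b n}^{⊗ d}` whose component on a sorted word of blocks is
the identity if every block occurs, and zero otherwise. -/
def diag (hq : q ≠ 0) (b n d : ℕ) : schur q n (b * n) d :=
  liftSchur hq _ (isParabolicLinear_diagComp q b n d)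

theorem blockProj_diag (hq : q ≠ 0) {β : Fin d → Fin b} (hβ : Monotone β) :
    blockProj K n β ∘ₗ (diag hq b n d).1 = diagComp K n β :=
  blockProj_liftSchur hq _ hβ

theorem blowUp_comp_diag (hq : q ≠ 0) (b : ℕ) (f : schur q n m d) :
    schurComp (blowUp hq b f) (diag hq b n d) = schurComp (diag hq b m d) f :=
  schur_ext_of_monotone fun β hβ => by
    change (blockProj K m β ∘ₗ (blowUp hq b f).1) ∘ₗ (diag hq b n d).1 =
      (blockProj K m β ∘ₗ (diag hq b m d).1) ∘ₗ f.1
    rw [blockProj_blowUp hq f hβ, blockProj_diag hq hβ, LinearMap.comp_assoc,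
      blockProj_diag hq hβ, comp_diagComp]

theorem blockProj_diag_of_not_surjective (hq : q ≠ 0) {β : Fin d → Fin b}
    (hβ : ¬ Function.Surjective β) : blockProj K n β ∘ₗ (diag hq b n d).1 = 0 := by
  induction β using sorting_induction with
  | monotone β sorted => rw [blockProj_diag hq sorted, diagComp_of_not_surjective hβ]
  | swap β i hi ih =>
    rw [blockProj_comp_eq_sortStep (schur_map_hecke _) hi, sortStep, ih fun h => hβ h.of_comp,
      LinearMap.zero_comp, LinearMap.comp_zero]

/-! ### Weights -/

theorem le_card_content_joinWord {β : Fin d → Fin b} (hβ : Function.Surjective β)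
    (v : Fin d → Fin n) :
    b ≤ (Finset.univ.filter fun j => content (joinWord β v) j ≠ 0).card := by
  obtain ⟨t, ht⟩ := hβ.hasRightInverse
  have occurs (c : Fin b) : content (joinWord β v) (joinWord β v (t c)) ≠ 0 :=
    Finset.card_ne_zero_of_mem (a := t c) (by simp)
  have injective : Function.Injective fun c => joinWord β v (t c) := fun c c' h => by
    have blocks_eq := (Prod.ext_iff.1 (finProdFinEquiv.injective h)).1
    rwa [ht, ht] at blocks_eq
  have := Finset.card_le_card_of_injOn (s := Finset.univ)
    (t := Finset.univ.filter fun j => content (joinWord β v) j ≠ 0)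
    (fun c => joinWord β v (t c)) (fun c _ => by simpa using occurs c) injective.injOn
  simpa using this

theorem weightProj_comp_blockIncl {β : Fin d → Fin b} (hβ : Function.Surjective β)
    {α : Fin (b * n) → ℕ} (hα : (Finset.univ.filter fun j => α j ≠ 0).card < b) :
    weightProj K (b * n) d α ∘ₗ blockIncl K n β = 0 := by
  refine (wordBasis K n d).ext fun v => ?_
  rw [LinearMap.comp_apply, blockIncl_wordBasis, weightProj, Module.Basis.constr_basis, if_neg,
    LinearMap.zero_apply]
  rintro rfl
  exact hα.not_ge (le_card_content_joinWord hβ v)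

theorem xi_comp_diag_eq_zero (hq : q ≠ 0) {α : Fin (b * n) → ℕ}
    (hα : (Finset.univ.filter fun j => α j ≠ 0).card < b) :
    schurComp (xi q (b * n) d α) (diag hq b n d) = 0 := by
  refine Subtype.ext (LinearMap.ext fun x => ?_)
  change weightProj K (b * n) d α ((diag hq b n d).1 x) = 0
  rw [← sum_blockIncl_blockProj ((diag hq b n d).1 x), map_sum]
  refine Finset.sum_eq_zero fun β _ => ?_
  by_cases hβ : Function.Surjective β
  · exact LinearMap.congr_fun (weightProj_comp_blockIncl hβ hα) _
  · rw [← LinearMap.comp_apply (blockProj K n β), blockProj_diag_of_not_surjective hq hβ,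
      LinearMap.zero_apply, map_zero, map_zero]

theorem sum_xi (q : K) (n d : ℕ) :
    ∑ α ∈ Finset.univ.image (content (n := n) (d := d)), xi q n d α = schurId q n d := by
  refine Subtype.ext ((wordBasis K n d).ext fun w => ?_)
  rw [Submodule.coe_sum, LinearMap.sum_apply]
  simp only [xi, weightProj, Module.Basis.constr_basis]
  rw [Finset.sum_ite_eq, if_pos (Finset.mem_image_of_mem _ (Finset.mem_univ w))]
  rfl

theorem HomogFunctor.act_eq_zero_of_xi_comp (F : HomogFunctor q d) {n m : ℕ+} (f : schur q n m d)
    (h : ∀ α, F.IsWeight m α → schurComp (xi q m d α) f = 0) : F.act n m f = 0 := by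
  have component_eq_zero (α) : F.act m m (xi q m d α) ∘ₗ F.act n m f = 0 := by
    by_cases hα : F.IsWeight m α
    · rw [← F.act_comp, h α hα, map_zero]
    · rw [IsWeight, not_not, LinearMap.range_eq_bot] at hα
      rw [hα, LinearMap.zero_comp]
  calc
    F.act n m f = LinearMap.lcomp K _ (F.act n m f) (F.act m m (schurId q m d)) := by
      rw [F.act_id]; rfl
    _ = ∑ α ∈ Finset.univ.image content, F.act m m (xi q m d α) ∘ₗ F.act n m f := by
      rw [← sum_xi, map_sum, map_sum]; rfl
    _ = 0 := Finset.sum_eq_zero fun α _ => component_eq_zero α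

/-- The rank `(k + 1) n` of the blow up of an object of rank `n`. -/
def blowUpRank (k : ℕ) (n : ℕ+) : ℕ+ := ⟨(k + 1) * n, Nat.mul_pos k.succ_pos n.pos⟩

theorem HomogFunctor.act_diag_eq_zero (hq : q ≠ 0) {k : ℕ} (F : HomogFunctor q d)
    (hF : ∀ (n : ℕ+) (α : Fin n → ℕ), F.IsWeight n α →
      (Finset.univ.filter fun j => α j ≠ 0).card ≤ k) (n : ℕ+) :
    F.act n (blowUpRank k n) (diag hq (k + 1) n d) = 0 :=
  F.act_eq_zero_of_xi_comp _ fun α hα => xi_comp_diag_eq_zero hq (Nat.lt_succ_of_le (hF _ α hα))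

end BlowUp

section Precomposition

variable {K : Type u} [Field K] {q : K}

/-! ### Precomposition with the blow up -/

/-- The endofunctor `V_n^{⊗ d} ↦ V_{(k + 1) n}^{⊗ d}` of the source category. -/
def blowUpFunctor (hq : q ≠ 0) (k d : ℕ) : Source q d ⥤ Source q d where
  obj X := ⟨blowUpRank k X.rank⟩
  map f := blowUp hq (k + 1) f
  map_id X := blowUp_id hq (k + 1) X.rank d
  map_comp f g := blowUp_comp hq (k + 1) g f

instance (hq : q ≠ 0) (k d : ℕ) : (blowUpFunctor hq k d).Additive where
  map_add {_ _ f g} := blowUp_add hq (k + 1) f g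

instance (hq : q ≠ 0) (k d : ℕ) : (blowUpFunctor hq k d).Linear K where
  map_smul f c := blowUp_smul hq (k + 1) c f

/-- The natural transformation with components `diag`. -/
def diagTransformation (hq : q ≠ 0) (k d : ℕ) : 𝟭 (Source q d) ⟶ blowUpFunctor hq k d where
  app X := diag hq (k + 1) X.rank d
  naturality _ _ f := (blowUp_comp_diag hq (k + 1) f).symm

/-- The endofunctor of the disjoint union of the source categories that is `blowUpFunctor` in each
degree. -/
def totalBlowUp (hq : q ≠ 0) (k : ℕ) : TotalSource q ⥤ TotalSource q :=
  Sigma.Functor.sigma fun d => blowUpFunctor hq k d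

/-- The natural transformation that is `diagTransformation` in each degree. -/
def totalDiag (hq : q ≠ 0) (k : ℕ) : 𝟭 (TotalSource q) ⟶ totalBlowUp hq k where
  app X := Sigma.SigmaHom.mk ((diagTransformation hq k X.1).app X.2)
  naturality := by
    rintro _ _ ⟨f⟩
    exact congrArg Sigma.SigmaHom.mk ((diagTransformation hq k _).naturality f)

theorem isQuantumPolynomial_totalBlowUp_comp (hq : q ≠ 0) (k : ℕ) (A : QPFunctor q) :
    IsQuantumPolynomial q (totalBlowUp hq k ⋙ A.obj) := by
  refine ⟨fun d => ?_, A.property.2.subset ?_⟩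
  · obtain ⟨_, _⟩ := A.property.1 d
    change IsKLinear (blowUpFunctor hq k d ⋙ (Sigma.incl d ⋙ A.obj))
    exact ⟨inferInstance, inferInstance⟩
  · exact fun d hd h => hd fun X => h ((blowUpFunctor hq k d).obj X)

/-- The endofunctor `A ↦ A((k + 1) n)` of the category of quantum polynomial functors. -/
def precompBlowUp (hq : q ≠ 0) (k : ℕ) : QPFunctor q ⥤ QPFunctor q :=
  ObjectProperty.lift _
    ((IsQuantumPolynomial q).ι ⋙ (Functor.whiskeringLeft _ _ _).obj (totalBlowUp hq k))
    (isQuantumPolynomial_totalBlowUp_comp hq k)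

instance (hq : q ≠ 0) (k : ℕ) : (precompBlowUp hq k).Additive where

instance : (IsQuantumPolynomial q).ι.PreservesHomology where
  preservesKernels _ _ f := ObjectProperty.preservesKernels_ι _ f
  preservesCokernels _ _ f := ObjectProperty.preservesCokernels_ι _ f

instance (hq : q ≠ 0) (k : ℕ) : (precompBlowUp hq k).PreservesHomology :=
  Functor.preservesHomology_of_map_exact _ fun _ hS =>
    (IsQuantumPolynomial q).ι.reflects_exact_of_faithful _
      ((hS.map (IsQuantumPolynomial q).ι).map
        ((Functor.whiskeringLeft _ _ (FGModuleCat.{u} K)).obj (totalBlowUp hq k)))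

/-- The natural transformation `A(n) → A((k + 1) n)` induced by `diag`. -/
def toPrecompBlowUp (hq : q ≠ 0) (k : ℕ) : 𝟭 (QPFunctor q) ⟶ precompBlowUp hq k where
  app A := ObjectProperty.homMk (Functor.whiskerRight (totalDiag hq k) A.obj)
  naturality _ _ f :=
    ObjectProperty.hom_ext _ (NatTrans.ext (funext fun _ => (f.hom.naturality _).symm))

theorem toPrecompBlowUp_app_eq_zero (hq : q ≠ 0) {k : ℕ} (A : QPFunctor q)
    (hA : ∀ (n : ℕ+) (α : Fin n → ℕ), A.IsWeight n α →
      (Finset.univ.filter fun j => α j ≠ 0).card ≤ k) :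
    (toPrecompBlowUp hq k).app A = 0 :=
  ObjectProperty.hom_ext _ (NatTrans.ext (funext fun X => FGModuleCat.hom_ext
    ((A.component X.1).act_diag_eq_zero hq (fun n α h => hA n α ⟨_, h⟩) X.2.rank)))

end Precomposition

section LinearExtension

variable {K : Type u} [Field K] {q : K}

/-! ### Extending a homogeneous functor to all linear maps -/

/-- For each `n` and `m`, a linear extension of the action of `F` from the Hecke linear maps
`V_n^{⊗ d} → V_m^{⊗ d}` to all linear maps. It is not required to respect composition. -/
structure LinearExtension {d : ℕ} (F : HomogFunctor q d) where
  /-- The extended action. -/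
  act (n m : ℕ+) : (TensorSpace K n d →ₗ[K] TensorSpace K m d) →ₗ[K] F.val n →ₗ[K] F.val m
  act_coe {n m : ℕ+} (f : schur q n m d) : act n m f.1 = F.act n m f

/-- The extension `E` respects the composition of `p` with Hecke linear maps on both sides. -/
structure LinearExtension.IsBimodular {d : ℕ} {F : HomogFunctor q d} (E : LinearExtension F)
    {n m : ℕ+} (p : TensorSpace K n d →ₗ[K] TensorSpace K m d) : Prop where
  act_comp_coe {r : ℕ+} (g : schur q r n d) : E.act r m (p ∘ₗ g.1) = E.act n m p ∘ₗ F.act r n g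
  act_coe_comp {r : ℕ+} (f : schur q m r d) : E.act n r (f.1 ∘ₗ p) = F.act m r f ∘ₗ E.act n m p

instance {d : ℕ} (F : HomogFunctor q d) : Nonempty (LinearExtension F) := by
  choose act hact using fun n m => LinearMap.exists_extend (F.act n m)
  exact ⟨⟨act, fun {n m} f => LinearMap.congr_fun (hact n m) f⟩⟩

theorem LinearExtension.isBimodular_coe {d : ℕ} {F : HomogFunctor q d} (E : LinearExtension F)
    {n m : ℕ+} (p : schur q n m d) : E.IsBimodular p.1 where
  act_comp_coe g := by
    rw [E.act_coe, ← F.act_comp, ← E.act_coe]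
    rfl
  act_coe_comp f := by
    rw [E.act_coe, ← F.act_comp, ← E.act_coe]
    rfl

variable {d₁ d₂ : ℕ}

/-- The identification of a tensor product of spaces of linear maps with the linear maps
`V_n^{⊗ (d₁ + d₂)} → V_m^{⊗ (d₁ + d₂)}`. -/
def juxtapose (K : Type u) [Field K] (n m d₁ d₂ : ℕ) :
    (TensorSpace K n d₁ →ₗ[K] TensorSpace K m d₁) ⊗[K]
        (TensorSpace K n d₂ →ₗ[K] TensorSpace K m d₂) ≃ₗ[K]
      (TensorSpace K n (d₁ + d₂) →ₗ[K] TensorSpace K m (d₁ + d₂)) :=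
  homTensorHomEquiv K _ _ _ _ ≪≫ₗ (concat K n d₁ d₂).arrowCongr (concat K m d₁ d₂)

theorem juxtapose_tmul {n m : ℕ} (p₁ : TensorSpace K n d₁ →ₗ[K] TensorSpace K m d₁)
    (p₂ : TensorSpace K n d₂ →ₗ[K] TensorSpace K m d₂) :
    juxtapose K n m d₁ d₂ (p₁ ⊗ₜ p₂) = (concat K n d₁ d₂).arrowCongr (concat K m d₁ d₂)
      (TensorProduct.map p₁ p₂) := by
  rw [juxtapose, LinearEquiv.trans_apply, homTensorHomEquiv_apply,
    TensorProduct.homTensorHomMap_apply]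

theorem juxtapose_tmul_comp_tmul {n r m : ℕ} (g₁ : TensorSpace K r d₁ →ₗ[K] TensorSpace K m d₁)
    (g₂ : TensorSpace K r d₂ →ₗ[K] TensorSpace K m d₂)
    (f₁ : TensorSpace K n d₁ →ₗ[K] TensorSpace K r d₁)
    (f₂ : TensorSpace K n d₂ →ₗ[K] TensorSpace K r d₂) :
    juxtapose K r m d₁ d₂ (g₁ ⊗ₜ g₂) ∘ₗ juxtapose K n r d₁ d₂ (f₁ ⊗ₜ f₂) =
      juxtapose K n m d₁ d₂ ((g₁ ∘ₗ f₁) ⊗ₜ (g₂ ∘ₗ f₂)) := by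
  simp only [juxtapose_tmul, TensorProduct.map_comp]
  exact (LinearEquiv.arrowCongr_comp _ _ _ _ _).symm

/-- The inclusion of `S_q(n, m; d₁) ⊗ S_q(n, m; d₂)` into the linear maps
`V_n^{⊗ (d₁ + d₂)} → V_m^{⊗ (d₁ + d₂)}`. -/
def juxtaposeSchur (q : K) (n m d₁ d₂ : ℕ) :
    schur q n m d₁ ⊗[K] schur q n m d₂ →ₗ[K]
      (TensorSpace K n (d₁ + d₂) →ₗ[K] TensorSpace K m (d₁ + d₂)) :=
  (juxtapose K n m d₁ d₂).toLinearMap ∘ₗ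
    TensorProduct.map (schur q n m d₁).subtype (schur q n m d₂).subtype

theorem juxtaposeSchur_schurComul (n m : ℕ) (f : schur q n m (d₁ + d₂)) :
    juxtaposeSchur q n m d₁ d₂ (schurComul q n m d₁ d₂ f) = f.1 := by
  have h := schurTensor_schurComul q n m d₁ d₂ f
  refine Eq.trans ?_ (((concat K n d₁ d₂).arrowCongr (concat K m d₁ d₂)).apply_symm_apply f.1)
  refine congrArg ((concat K n d₁ d₂).arrowCongr (concat K m d₁ d₂)) (Eq.trans ?_ h)
  exact homTensorHomEquiv_apply _

namespace LinearExtension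

variable {F : HomogFunctor q d₁} {G : HomogFunctor q d₂}

/-- The action of `E₁ ⊗ E₂` on the tensor product of two spaces of linear maps. -/
def tensorAct (E₁ : LinearExtension F) (E₂ : LinearExtension G) (n m : ℕ+) :
    (TensorSpace K n d₁ →ₗ[K] TensorSpace K m d₁) ⊗[K]
        (TensorSpace K n d₂ →ₗ[K] TensorSpace K m d₂) →ₗ[K]
      ((F.tensor G).val n →ₗ[K] (F.tensor G).val m) :=
  TensorProduct.homTensorHomMap (.id K) _ _ _ _ ∘ₗ TensorProduct.map (E₁.act n m) (E₂.act n m)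

theorem tensorAct_map_subtype (E₁ : LinearExtension F) (E₂ : LinearExtension G) (n m : ℕ+)
    (y : schur q n m d₁ ⊗[K] schur q n m d₂) :
    E₁.tensorAct E₂ n m
        (TensorProduct.map (schur q n m d₁).subtype (schur q n m d₂).subtype y) =
      QuantumFunctor.tensorAct F G n m y := by
  have h₁ : E₁.act n m ∘ₗ (schur q n m d₁).subtype = F.act n m := LinearMap.ext E₁.act_coe
  have h₂ : E₂.act n m ∘ₗ (schur q n m d₂).subtype = G.act n m := LinearMap.ext E₂.act_coe
  rw [QuantumFunctor.tensorAct, ← h₁, ← h₂, TensorProduct.map_comp]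
  rfl

/-- The tensor product of two extensions. -/
def tensor (E₁ : LinearExtension F) (E₂ : LinearExtension G) :
    LinearExtension (F.tensor G) where
  act n m := E₁.tensorAct E₂ n m ∘ₗ (juxtapose K n m d₁ d₂).symm.toLinearMap
  act_coe {n m} f := by
    rw [← juxtaposeSchur_schurComul, LinearMap.comp_apply, juxtaposeSchur, LinearMap.comp_apply]
    refine (congrArg _ ((juxtapose K n m d₁ d₂).symm_apply_apply _)).trans ?_
    exact tensorAct_map_subtype ..

theorem tensor_act_juxtapose_tmul (E₁ : LinearExtension F) (E₂ : LinearExtension G) {n m : ℕ+}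
    (p₁ : TensorSpace K n d₁ →ₗ[K] TensorSpace K m d₁)
    (p₂ : TensorSpace K n d₂ →ₗ[K] TensorSpace K m d₂) :
    (E₁.tensor E₂).act n m (juxtapose K n m d₁ d₂ (p₁ ⊗ₜ p₂)) =
      TensorProduct.map (E₁.act n m p₁) (E₂.act n m p₂) :=
  congrArg (E₁.tensorAct E₂ n m) ((juxtapose K n m d₁ d₂).symm_apply_apply _)

theorem IsBimodular.juxtapose {E₁ : LinearExtension F} {E₂ : LinearExtension G} {n m : ℕ+}
    {p₁ : TensorSpace K n d₁ →ₗ[K] TensorSpace K m d₁}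
    {p₂ : TensorSpace K n d₂ →ₗ[K] TensorSpace K m d₂}
    (h₁ : E₁.IsBimodular p₁) (h₂ : E₂.IsBimodular p₂) :
    (E₁.tensor E₂).IsBimodular (juxtapose K n m d₁ d₂ (p₁ ⊗ₜ p₂)) where
  act_comp_coe {r} g := by
    suffices ∀ y : schur q r n d₁ ⊗[K] schur q r n d₂,
        (E₁.tensor E₂).act r m
            (QuantumFunctor.juxtapose K n m d₁ d₂ (p₁ ⊗ₜ p₂) ∘ₗ juxtaposeSchur q r n d₁ d₂ y) =
          (E₁.tensor E₂).act n m (QuantumFunctor.juxtapose K n m d₁ d₂ (p₁ ⊗ₜ p₂)) ∘ₗ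
            QuantumFunctor.tensorAct F G r n y by
      have comp_comul := this (schurComul q r n d₁ d₂ g)
      rwa [juxtaposeSchur_schurComul] at comp_comul
    intro y
    induction y with
    | zero =>
      rw [map_zero, map_zero, LinearMap.comp_zero, map_zero]
      exact (LinearMap.comp_zero _).symm
    | add y y' hy hy' =>
      rw [map_add, map_add, LinearMap.comp_add, map_add, hy, hy']
      exact (LinearMap.comp_add ..).symm
    | tmul g₁ g₂ =>
      rw [tensorAct_tmul, juxtaposeSchur, LinearMap.comp_apply, TensorProduct.map_tmul,
        LinearEquiv.coe_coe, juxtapose_tmul_comp_tmul, tensor_act_juxtapose_tmul,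
        tensor_act_juxtapose_tmul]
      exact (congrArg₂ TensorProduct.map (h₁.act_comp_coe g₁) (h₂.act_comp_coe g₂)).trans
        (TensorProduct.map_comp ..)
  act_coe_comp {r} f := by
    suffices ∀ y : schur q m r d₁ ⊗[K] schur q m r d₂,
        (E₁.tensor E₂).act n r
            (juxtaposeSchur q m r d₁ d₂ y ∘ₗ QuantumFunctor.juxtapose K n m d₁ d₂ (p₁ ⊗ₜ p₂)) =
          QuantumFunctor.tensorAct F G m r y ∘ₗ
            (E₁.tensor E₂).act n m (QuantumFunctor.juxtapose K n m d₁ d₂ (p₁ ⊗ₜ p₂)) by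
      have comul_comp := this (schurComul q m r d₁ d₂ f)
      rwa [juxtaposeSchur_schurComul] at comul_comp
    intro y
    induction y with
    | zero =>
      rw [map_zero, map_zero, LinearMap.zero_comp, map_zero]
      exact (LinearMap.zero_comp _).symm
    | add y y' hy hy' =>
      rw [map_add, map_add, LinearMap.add_comp, map_add, hy, hy']
      exact (LinearMap.add_comp ..).symm
    | tmul f₁ f₂ =>
      rw [tensorAct_tmul, juxtaposeSchur, LinearMap.comp_apply, TensorProduct.map_tmul,
        LinearEquiv.coe_coe, juxtapose_tmul_comp_tmul, tensor_act_juxtapose_tmul,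
        tensor_act_juxtapose_tmul]
      exact (congrArg₂ TensorProduct.map (h₁.act_coe_comp f₁) (h₂.act_coe_comp f₂)).trans
        (TensorProduct.map_comp ..)

end LinearExtension

end LinearExtension

section Retraction

variable {K : Type u} [Field K] {q : K}

/-! ### The retraction of the blow up of a tensor product -/

theorem comp_append {α β : Type*} {m n : ℕ} (f : α → β) (v : Fin m → α) (w : Fin n → α) :
    f ∘ Fin.append v w = Fin.append (f ∘ v) (f ∘ w) :=
  funext <| Fin.addCases (fun _ => by simp) (fun _ => by simp)

theorem monotone_append {α : Type*} [Preorder α] {m n : ℕ} {v : Fin m → α} {w : Fin n → α}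
    (hv : Monotone v) (hw : Monotone w) (h : ∀ s t, v s ≤ w t) : Monotone (Fin.append v w) := by
  intro s t hst
  induction s using Fin.addCases with
  | left s =>
    induction t using Fin.addCases with
    | left t => simpa using hv (Fin.le_def.2 (Fin.le_def.1 hst))
    | right t => simpa using h s t
  | right s =>
    induction t using Fin.addCases with
    | left t =>
      have := Fin.le_def.1 hst
      simp only [Fin.val_natAdd, Fin.val_castAdd] at this
      omega
    | right t => simpa using hw (by simpa using hst)

/-- The word `0 ⋯ 0 1 ⋯ 1 ⋯ k ⋯ k` in which the letter `i` occurs `d i` times. -/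
def blockIndex : (k : ℕ) → (d : Fin (k + 1) → ℕ) → Fin (totalDegree k d) → Fin (k + 1)
  | 0, _ => fun _ => 0
  | k + 1, d => Fin.append (fun _ : Fin (d 0) => 0) (Fin.succ ∘ blockIndex k fun i => d i.succ)

theorem monotone_blockIndex (k : ℕ) (d : Fin (k + 1) → ℕ) : Monotone (blockIndex k d) := by
  induction k with
  | zero => exact monotone_const
  | succ k ih =>
    exact monotone_append monotone_const ((Fin.strictMono_succ).monotone.comp (ih _))
      fun _ _ => Fin.zero_le _

theorem surjective_blockIndex (k : ℕ) (d : Fin (k + 1) → ℕ) (hd : ∀ i, 1 ≤ d i) :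
    Function.Surjective (blockIndex k d) := by
  induction k with
  | zero => exact fun c => ⟨⟨0, hd 0⟩, Subsingleton.elim (α := Fin 1) _ _⟩
  | succ k ih =>
    intro c
    induction c using Fin.cases with
    | zero => exact ⟨Fin.castAdd _ ⟨0, hd 0⟩, Fin.append_left ..⟩
    | succ c =>
      obtain ⟨t, rfl⟩ := ih _ (fun i => hd i.succ) c
      exact ⟨Fin.natAdd _ t, Fin.append_right ..⟩

theorem blockProj_append {b n d₁ d₂ : ℕ} (β₁ : Fin d₁ → Fin b) (β₂ : Fin d₂ → Fin b) :
    blockProj K n (Fin.append β₁ β₂) =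
      juxtapose K (b * n) n d₁ d₂ (blockProj K n β₁ ⊗ₜ blockProj K n β₂) := by
  refine (wordBasis K _ _).ext fun w => ?_
  obtain ⟨⟨w₁, w₂⟩, rfl⟩ := (Fin.appendEquiv d₁ d₂).surjective w
  change blockProj K n _ (wordBasis K _ _ (Fin.append w₁ w₂)) =
    juxtapose K (b * n) n d₁ d₂ _ (wordBasis K _ _ (Fin.append w₁ w₂))
  rw [blockProj_wordBasis, ← concat_wordBasis, juxtapose_tmul, LinearEquiv.arrowCongr_apply,
    LinearEquiv.symm_apply_apply, TensorProduct.map_tmul]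
  have blocks : blockWord (Fin.append w₁ w₂) = Fin.append (blockWord w₁) (blockWord w₂) :=
    comp_append (fun x => (finProdFinEquiv.symm x).1) w₁ w₂
  have values : valueWord (Fin.append w₁ w₂) = Fin.append (valueWord w₁) (valueWord w₂) :=
    comp_append (fun x => (finProdFinEquiv.symm x).2) w₁ w₂
  have eq_iff : Fin.append (blockWord w₁) (blockWord w₂) = Fin.append β₁ β₂ ↔
      blockWord w₁ = β₁ ∧ blockWord w₂ = β₂ :=
    (Fin.appendEquiv d₁ d₂).injective.eq_iff (a := (blockWord w₁, blockWord w₂))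
      (b := (β₁, β₂)) |>.trans Prod.ext_iff
  simp only [blockProj_wordBasis, blocks, values, eq_iff]
  split_ifs <;> simp_all [concat_wordBasis]

/-- The projection onto the words with all letters in one block is Hecke linear. -/
def blockProjConst (q : K) {b : ℕ} (n d : ℕ) (c : Fin b) : schur q (b * n) n d :=
  ⟨blockProj K n fun _ => c, fun i hi =>
    LinearMap.ext fun x => blockProj_hecke_of_eq q (i := ⟨i, hi⟩) (β := fun _ => c) rfl x⟩

/-- The relabelling `c` allows an induction over `k` with a fixed number `l + 1` of blocks. -/
theorem exists_isBimodular_tensorAll (l k : ℕ) (c : Fin (k + 1) → Fin (l + 1))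
    (d : Fin (k + 1) → ℕ) (F : (i : Fin (k + 1)) → HomogFunctor q (d i)) :
    ∃ E : LinearExtension (tensorAll k d F), ∀ n : ℕ+,
      E.IsBimodular (n := blowUpRank l n) (blockProj K n (c ∘ blockIndex k d)) := by
  induction k with
  | zero =>
    obtain ⟨E⟩ : Nonempty (LinearExtension (tensorAll 0 d F)) := inferInstance
    exact ⟨E, fun n => E.isBimodular_coe (n := blowUpRank l n) (blockProjConst q n (d 0) (c 0))⟩
  | succ k ih =>
    obtain ⟨E₁⟩ : Nonempty (LinearExtension (F 0)) := inferInstance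
    obtain ⟨E₂, h₂⟩ := ih (c ∘ Fin.succ) (fun i => d i.succ) fun i => F i.succ
    refine ⟨E₁.tensor E₂, fun n => ?_⟩
    have h₁ := E₁.isBimodular_coe (n := blowUpRank l n) (blockProjConst q n (d 0) (c 0))
    have append_eq : c ∘ blockIndex (k + 1) d = Fin.append (fun _ : Fin (d 0) => c 0)
        ((c ∘ Fin.succ) ∘ blockIndex k fun i => d i.succ) := comp_append ..
    rw [append_eq]
    exact (congrArg _ (blockProj_append ..)).mpr (h₁.juxtapose (h₂ n))

/-- The morphisms `diag` induce a split monomorphism from `F(n)` to `F((k + 1) n)`, with a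
retraction natural in `n`. -/
def HomogFunctor.IsBlowUpRetract (hq : q ≠ 0) (k : ℕ) {d : ℕ} (F : HomogFunctor q d) : Prop :=
  ∃ ρ : blowUpFunctor hq k d ⋙ F.obj ⟶ F.obj,
    Functor.whiskerRight (diagTransformation hq k d) F.obj ≫ ρ = F.obj.leftUnitor.hom

theorem LinearExtension.isBlowUpRetract (hq : q ≠ 0) {k d : ℕ} {F : HomogFunctor q d}
    (E : LinearExtension F) {β : Fin d → Fin (k + 1)} (hβ : Monotone β)
    (hβ' : Function.Surjective β)
    (hE : ∀ n : ℕ+, E.IsBimodular (n := blowUpRank k n) (blockProj K n β)) :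
    F.IsBlowUpRetract hq k := by
  let ρ : blowUpFunctor hq k d ⋙ F.obj ⟶ F.obj :=
    { app X := FGModuleCat.ofHom (E.act (blowUpRank k X.rank) X.rank (blockProj K X.rank β))
      naturality X Y f := FGModuleCat.hom_ext <| by
        refine ((hE Y.rank).act_comp_coe (r := blowUpRank k X.rank)
          (blowUp hq (k + 1) f)).symm.trans ?_
        refine (congrArg _ (blockProj_blowUp hq f hβ)).trans ?_
        exact (hE X.rank).act_coe_comp f }
  refine ⟨ρ, NatTrans.ext (funext fun X => FGModuleCat.hom_ext ?_)⟩
  refine ((hE X.rank).act_comp_coe (diag hq (k + 1) X.rank d)).symm.trans ?_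
  calc
    _ = E.act X.rank X.rank (schurId q X.rank d).1 :=
      congrArg _ ((blockProj_diag hq hβ).trans (diagComp_of_surjective hβ'))
    _ = LinearMap.id := (E.act_coe _).trans (F.act_id _)

theorem isBlowUpRetract_tensorAll (hq : q ≠ 0) {k : ℕ} {d : Fin (k + 1) → ℕ} (hd : ∀ i, 1 ≤ d i)
    (F : (i : Fin (k + 1)) → HomogFunctor q (d i)) :
    (tensorAll k d F).IsBlowUpRetract hq k := by
  obtain ⟨E, hE⟩ := exists_isBimodular_tensorAll k k id d F
  exact E.isBlowUpRetract hq (monotone_blockIndex k d) (surjective_blockIndex k d hd) hE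

theorem HomogFunctor.isBlowUpRetract_of_isZero (hq : q ≠ 0) (k : ℕ) {d : ℕ} {F : HomogFunctor q d}
    (hF : ∀ X, IsZero (F.obj.obj X)) : F.IsBlowUpRetract hq k :=
  ⟨0, NatTrans.ext (funext fun X => (hF X).eq_of_tgt _ _)⟩

theorem component_toQP_obj {d : ℕ} (F : HomogFunctor q d) (e : ℕ) :
    (F.toQP.component e).obj = Function.update (fun e => (Functor.const (Source q e)).obj
      (FGModuleCat.of K PUnit.{u + 1})) d F.obj e := rfl

theorem component_toQP_self {d : ℕ} (F : HomogFunctor q d) : F.toQP.component d = F :=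
  ObjectProperty.FullSubcategory.ext (by rw [component_toQP_obj, Function.update_self])

theorem isZero_component_toQP {d e : ℕ} (h : e ≠ d) (F : HomogFunctor q d) (X : Source q e) :
    IsZero ((F.toQP.component e).obj.obj X) := by
  rw [component_toQP_obj, Function.update_of_ne h, IsZero.iff_id_eq_zero]
  exact FGModuleCat.hom_ext (LinearMap.ext fun _ => rfl)

theorem HomogFunctor.IsBlowUpRetract.component_toQP {hq : q ≠ 0} {k d : ℕ} {F : HomogFunctor q d}
    (hF : F.IsBlowUpRetract hq k) (e : ℕ) : (F.toQP.component e).IsBlowUpRetract hq k := by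
  by_cases h : e = d
  · subst h
    rwa [component_toQP_self]
  · exact isBlowUpRetract_of_isZero hq k (isZero_component_toQP h F)

theorem exists_retraction_toPrecompBlowUp (hq : q ≠ 0) {k : ℕ} {A : QPFunctor q}
    (hA : ∀ e, (A.component e).IsBlowUpRetract hq k) :
    ∃ ρ : (precompBlowUp hq k).obj A ⟶ A, (toPrecompBlowUp hq k).app A ≫ ρ = 𝟙 A := by
  choose ρ hρ using hA
  refine ⟨ObjectProperty.homMk (Sigma.natTrans ρ), ?_⟩
  exact ObjectProperty.hom_ext _ (NatTrans.ext (funext fun X => NatTrans.congr_app (hρ X.1) X.2))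

end Retraction

end QuantumFunctor

end

theorem mainTheorem11 {K : Type u} [Field K] (q : K) (hq : q ≠ 0) (k : ℕ)
    (A : QuantumFunctor.QPFunctor q)
    (hA : ∀ (n : ℕ+) (α : Fin n → ℕ), A.IsWeight n α →
      (Finset.univ.filter fun j => α j ≠ 0).card ≤ k)
    (d : Fin (k + 1) → ℕ) (hd : ∀ i, 1 ≤ d i)
    (F : (i : Fin (k + 1)) → QuantumFunctor.HomogFunctor q (d i)) (s : ℕ) :
    Subsingleton (Abelian.Ext A (QuantumFunctor.tensorAll k d F).toQP s) := by
  obtain ⟨ρ, hρ⟩ := QuantumFunctor.exists_retraction_toPrecompBlowUp hq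
    (QuantumFunctor.isBlowUpRetract_tensorAll hq hd F).component_toQP
  exact QuantumFunctor.subsingleton_ext_of_app_eq_zero (QuantumFunctor.toPrecompBlowUp hq k)
    (QuantumFunctor.toPrecompBlowUp_app_eq_zero hq A hA) ρ hρ s
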